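/- Let $\mathbb S^3=\{(z_1,z_2)\in\mathbb C^2:|z_1|^2+|z_2|^2=1\}$ carry its round metric, with volume measure $\mathrm{dVol}$ and one-dimensional Hausdorff measure $\mathscr H^1$, and let $$H_0=\{(z_1,0):|z_1|=1\},\qquad H_1=\{(0,z_2):|z_2|=1\}$$ be the two components of the standard Hopf link. A \emph{curve} is a subset of $\mathbb S^3$ with more than one point which is a continuous image of $[0,1]$. Two curves $C_0,C_1\subset\mathbb S^3$ are \emph{linked} if $C_0$ is not null-homotopic in $\mathbb S^3\setminus C_1$ and $C_1$ is not null-homotopic in $\mathbb S^3\setminus C_0$; here a set $A$ is null-homotopic in $U$ if $A\subset U$ and the inclusion $A\hookrightarrow U$ is homotopic to a constant map. Let $\Delta(C_0,C_1)$ be the family of all continuous paths $\gamma\colon[0,1]\to\mathbb S^3$ with $\gamma(0)\in C_0$ and $\gamma(1)\in C_1$. For a family $\Gamma$ of paths, put $$\mathrm{Mod}_3(\Gamma)=\inf_\rho\int_{\mathbb S^3}\rho^3\,\mathrm{dVol}\in[0,\infty],$$ where the infimum is over all Borel functions $\rho\colon\mathbb S^3\to[0,\infty]$ with $\int_{\gamma([0,1])}\rho\,\mathrm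 d\mathscr H^1\ge 1$ for all $\gamma\in\Gamma$ (and is $\infty$ if there is no such $\rho$). \textbf{Proposition.} Let $C_0,C_1\subset\mathbb S^3$ be linked curves such that $C_0$ is a round circle. Then $$\mathrm{Mod}_3(\Delta(H_0,H_1))\le \mathrm{Mod}_3(\Delta(C_0,C_1)).$$ -/

import Mathlib

open MeasureTheory Set
open scoped ENNReal unitInterval

/-- The unit sphere `𝕊³ ⊆ ℝ⁴ = ℂ²`, a point `x` standing for
`(z₁, z₂) = (x 0 + i x 1, x 2 + i x 3)`. -/
abbrev S3 : Type := Metric.sphere (0 : EuclideanSpace ℝ (Fin 4)) 1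

/-- The Riemannian volume measure of the round sphere `𝕊³` (the surface measure, of total
mass `2π²`). -/
noncomputable def volS3 : Measure S3 :=
  (volume : Measure (EuclideanSpace ℝ (Fin 4))).toSphere

/-- A curve: a continuous image of the unit interval that contains more than one point. -/
def IsCurve (C : Set S3) : Prop :=
  C.Nontrivial ∧ ∃ γ : C(I, S3), range γ = C

/-- A (round) circle contained in `𝕊³`. -/
def IsCircle (C : Set S3) : Prop :=
  ∃ (c u v : EuclideanSpace ℝ (Fin 4)) (r : ℝ), 0 < r ∧ Orthonormal ℝ ![u, v] ∧
    ((↑) '' C : Set (EuclideanSpace ℝ (Fin 4))) =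
      range fun t : ℝ => c + r • (Real.cos t • u + Real.sin t • v)

/-- `A` is null-homotopic in `U`: it is contained in `U`, and the inclusion `A → U` is
homotopic to a constant map. -/
def NullhomotopicIn (A U : Set S3) : Prop :=
  ∃ h : A ⊆ U, (⟨inclusion h, continuous_inclusion h⟩ : C(A, U)).Nullhomotopic

/-- Neither of the two sets is null-homotopic in the complement of the other. -/
def Linked (C₀ C₁ : Set S3) : Prop :=
  ¬ NullhomotopicIn C₀ C₁ᶜ ∧ ¬ NullhomotopicIn C₁ C₀ᶜ

/-- Borel densities `ρ : 𝕊³ → [0, ∞]` with `∫_γ ρ dℋ¹ ≥ 1` for every path `γ` of the family. -/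
def Admissible (Γ : Set C(I, S3)) : Set (S3 → ℝ≥0∞) :=
  {ρ | Measurable ρ ∧ ∀ γ ∈ Γ, 1 ≤ ∫⁻ x in range γ, ρ x ∂μH[1]}

/-- The path `p`-modulus of a family of paths in `𝕊³`. -/
noncomputable def pathModulus (p : ℝ) (Γ : Set C(I, S3)) : ℝ≥0∞ :=
  ⨅ ρ ∈ Admissible Γ, ∫⁻ x, ρ x ^ p ∂volS3

/-- The family `Δ(C₀, C₁)` of paths that connect `C₀` and `C₁`. -/
def connectingPaths (C₀ C₁ : Set S3) : Set C(I, S3) :=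
  {γ | γ 0 ∈ C₀ ∧ γ 1 ∈ C₁}

/-- The component `{(z₁, 0) : |z₁| = 1}` of the Hopf link. -/
def hopf₀ : Set S3 := {x | x.1 2 = 0 ∧ x.1 3 = 0}

/-- The component `{(0, z₂) : |z₂| = 1}` of the Hopf link. -/
def hopf₁ : Set S3 := {x | x.1 0 = 0 ∧ x.1 1 = 0}

/-!
Stereographic projection from a point of the circle `C₀` makes `C₀` a line. The half-planes bounded
by this line are the pages of an open book, and since `C₁` is not null-homotopic in the complement
of `C₀`, it meets every page: the complement of a page is star-shaped. Each page is a hyperbolic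
half-plane. From a point of `C₁` in the page at angle `β`, consider the hyperbolic rays, with
initial direction `θ` and parametrized by the Euclidean radius `t` of the disc model; they end on
`C₀`. As stereographic projection, the inclusions of the pages and the maps between disc and
half-plane are conformal, the volume of the sphere in the coordinates `(β, θ, t)` is `v³ ω(t)`,
where `v` is the speed of the ray at `t` and `ω(t) = t (1 - t²) / 2` depends neither on `C₁` nor on
`β` and `θ`. For an admissible `ρ` each ray has length `∫ ρ v dt ≥ 1`, so Hölder's inequality
yields `∫ ρ³ v³ ω dt ≥ L⁻²` with `L = ∫ ω ^ (-1/2) dt`. Integration over `β` and `θ` shows that the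
modulus is at least `(2π)² L⁻²`. For the Hopf link, with the rays that start on `H₁` perpendicularly
to it, the density `ω(t) ^ (-1/2) / (L v)` is a function of `|z₁| / (1 + |z₂|)`; it is admissible
and gives equality.
-/

open Filter Topology Metric Module
open scoped RealInnerProductSpace

/-- `f` distorts distances on `s` like a Möbius transformation with conformal factor `h`: squared
distances get multiplied by the product of the factors at the two points. -/
def MobiusOn {X Y : Type*} [PseudoMetricSpace X] [PseudoMetricSpace Y] (f : X → Y) (h : X → ℝ)
    (s : Set X) : Prop :=
  ∀ ⦃x⦄, x ∈ s → ∀ ⦃y⦄, y ∈ s → dist (f x) (f y) ^ 2 = h x * h y * dist x y ^ 2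

namespace MobiusOn

section Metric

variable {X Y Z : Type*} [PseudoMetricSpace X] [PseudoMetricSpace Y] [PseudoMetricSpace Z]
  {f : X → Y} {h : X → ℝ} {s : Set X}

theorem mono {t : Set X} (hf : MobiusOn f h s) (hts : t ⊆ s) : MobiusOn f h t :=
  fun _ hx _ hy => hf (hts hx) (hts hy)

theorem comp {g : Y → Z} {k : Y → ℝ} {t : Set Y} (hg : MobiusOn g k t) (hf : MobiusOn f h s)
    (hst : MapsTo f s t) : MobiusOn (g ∘ f) (fun x => k (f x) * h x) s := by
  intro x hx y hy
  simp only [Function.comp_apply]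
  rw [hg (hst hx) (hst hy), hf hx hy]
  ring

theorem of_isometry (hf : Isometry f) : MobiusOn f (fun _ => 1) s :=
  fun x _ y _ => by rw [hf.dist_eq, one_mul, one_mul]

theorem injOn {X : Type*} [MetricSpace X] {f : X → Y} {h : X → ℝ} {s : Set X}
    (hf : MobiusOn f h s) (hpos : ∀ x ∈ s, 0 < h x) : InjOn f s := by
  intro x hx y hy hxy
  have hfactors : h x * h y ≠ 0 := (mul_pos (hpos x hx) (hpos y hy)).ne'
  have hdist := hf hx hy
  rw [hxy, dist_self, zero_pow two_ne_zero, zero_eq_mul] at hdist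
  exact dist_eq_zero.1 (pow_eq_zero_iff two_ne_zero |>.1 (hdist.resolve_left hfactors))

end Metric

section Deriv

variable {V W : Type*} [NormedAddCommGroup V] [NormedSpace ℝ V] [NormedAddCommGroup W]
  [NormedSpace ℝ W] {f : V → W} {f' : V →L[ℝ] W} {h : V → ℝ} {s : Set V} {x : V}

theorem norm_fderiv_apply (hf : MobiusOn f h s) (hs : s ∈ 𝓝 x) (hx : 0 ≤ h x)
    (hh : ContinuousAt h x) (hf' : HasFDerivAt f f' x) (v : V) : ‖f' v‖ = h x * ‖v‖ := by
  have hline : Tendsto (fun t : ℝ => x + t • v) (𝓝[≠] 0) (𝓝 x) := by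
    exact tendsto_nhdsWithin_of_tendsto_nhds (Continuous.tendsto' (by fun_prop) 0 x (by simp))
  have hslope : Tendsto (fun t : ℝ => ‖t⁻¹ • (f (x + t • v) - f x)‖ ^ 2) (𝓝[≠] 0)
      (𝓝 (‖f' v‖ ^ 2)) :=
    ((hf'.hasLineDerivAt v).tendsto_slope_zero.norm).pow 2
  have hfactor : Tendsto (fun t : ℝ => h (x + t • v) * h x * ‖v‖ ^ 2) (𝓝[≠] 0)
      (𝓝 (h x * h x * ‖v‖ ^ 2)) :=
    ((hh.tendsto.comp hline).mul_const _).mul_const _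
  have hsq : ‖f' v‖ ^ 2 = h x * h x * ‖v‖ ^ 2 := by
    refine tendsto_nhds_unique (hslope.congr' ?_) hfactor
    filter_upwards [hline hs, self_mem_nhdsWithin] with t ht ht0
    have ht0 : t ≠ 0 := ht0
    rw [norm_smul, mul_pow, ← dist_eq_norm, hf ht (mem_of_mem_nhds hs), dist_self_add_left,
      norm_smul, norm_inv, mul_pow]
    field_simp
  rw [← sq_eq_sq₀ (norm_nonneg _) (by positivity), hsq]
  ring

end Deriv

end MobiusOn

section Hausdorff

theorem iUnion_inter_preimage_Ico_zpow {X : Type*} {A : Set X} {h : X → ℝ}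
    (hpos : ∀ x ∈ A, 0 < h x) {c : ℝ} (hc : 1 < c) :
    ⋃ n : ℤ, A ∩ h ⁻¹' Ico (c ^ n) (c ^ (n + 1)) = A := by
  refine (iUnion_subset fun _ => inter_subset_left).antisymm fun x hx => ?_
  obtain ⟨n, hn⟩ := exists_mem_Ico_zpow (hpos x hx) hc
  exact mem_iUnion.2 ⟨n, hx, hn⟩

theorem pairwise_disjoint_inter_preimage_Ico_zpow {X : Type*} (A : Set X) (h : X → ℝ)
    {c : ℝ} (hc : 1 < c) :
    Pairwise (Function.onFun Disjoint fun n : ℤ => A ∩ h ⁻¹' Ico (c ^ n) (c ^ (n + 1))) := by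
  refine fun m n hmn => Set.disjoint_left.2 fun x hm hn => hmn ?_
  have hmn' := (zpow_lt_zpow_iff_right₀ hc).1 (hm.2.1.trans_lt hn.2.2)
  have hnm' := (zpow_lt_zpow_iff_right₀ hc).1 (hn.2.1.trans_lt hm.2.2)
  omega

variable {X Y : Type*} [MetricSpace X] [MeasurableSpace X] [BorelSpace X] [MetricSpace Y]
  [MeasurableSpace Y] [BorelSpace Y] {f : X → Y} {h : X → ℝ} {A : Set X} {d : ℝ}

theorem hausdorffMeasure_image_le_of_factor_mem_Icc (hd : 0 ≤ d) (hA : MeasurableSet A)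
    (hf : ∀ x ∈ A, ∀ y ∈ A, dist (f x) (f y) ^ 2 ≤ h x * h y * dist x y ^ 2) {c m : ℝ}
    (hc : 0 < c) (hm : 0 < m) (hh : ∀ x ∈ A, h x ∈ Icc m (c * m)) :
    μH[d] (f '' A) ≤ ENNReal.ofReal c ^ d * ∫⁻ x in A, ENNReal.ofReal (h x) ^ d ∂μH[d] := by
  have hlip : LipschitzOnWith (c * m).toNNReal f A := by
    refine LipschitzOnWith.of_dist_le_mul fun x hx y hy => ?_
    rw [Real.coe_toNNReal _ (by positivity), ← sq_le_sq₀ dist_nonneg (by positivity), mul_pow,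
      sq (c * m)]
    refine (hf x hx y hy).trans ?_
    have hy0 : 0 ≤ h y := hm.le.trans (hh y hy).1
    gcongr
    exacts [(hh x hx).2, (hh y hy).2]
  have hlower : ENNReal.ofReal m ^ d * μH[d] A ≤ ∫⁻ x in A, ENNReal.ofReal (h x) ^ d ∂μH[d] := by
    rw [← setLIntegral_const]
    refine setLIntegral_mono' hA fun x hx => ?_
    have := (hh x hx).1
    gcongr
  calc μH[d] (f '' A) ≤ ENNReal.ofReal (c * m) ^ d * μH[d] A := hlip.hausdorffMeasure_image_le hd
    _ = ENNReal.ofReal c ^ d * (ENNReal.ofReal m ^ d * μH[d] A) := by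
      rw [ENNReal.ofReal_mul hc.le, ENNReal.mul_rpow_of_nonneg _ _ hd, mul_assoc]
    _ ≤ _ := by gcongr

theorem hausdorffMeasure_image_le_lintegral_factor (hd : 0 ≤ d) (hA : MeasurableSet A)
    (hh : Measurable h) (hpos : ∀ x ∈ A, 0 < h x)
    (hf : ∀ x ∈ A, ∀ y ∈ A, dist (f x) (f y) ^ 2 ≤ h x * h y * dist x y ^ 2) :
    μH[d] (f '' A) ≤ ∫⁻ x in A, ENNReal.ofReal (h x) ^ d ∂μH[d] := by
  have hshells : ∀ c : ℝ, 1 < c → μH[d] (f '' A) ≤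
      ENNReal.ofReal c ^ d * ∫⁻ x in A, ENNReal.ofReal (h x) ^ d ∂μH[d] := by
    intro c hc
    let B : ℤ → Set X := fun n => A ∩ h ⁻¹' Ico (c ^ n) (c ^ (n + 1))
    have hBm : ∀ n, MeasurableSet (B n) := fun n => hA.inter (hh measurableSet_Ico)
    have hBu : ⋃ n, B n = A := iUnion_inter_preimage_Ico_zpow hpos hc
    have hBd : Pairwise (Function.onFun Disjoint B) :=
      pairwise_disjoint_inter_preimage_Ico_zpow A h hc
    have hc0 : 0 < c := one_pos.trans hc
    have hB : ∀ n, μH[d] (f '' B n) ≤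
        ENNReal.ofReal c ^ d * ∫⁻ x in B n, ENNReal.ofReal (h x) ^ d ∂μH[d] := fun n =>
      hausdorffMeasure_image_le_of_factor_mem_Icc hd (hBm n)
        (fun x hx y hy => hf x hx.1 y hy.1) hc0 (zpow_pos hc0 n)
        fun x hx => ⟨hx.2.1, hx.2.2.le.trans_eq (by rw [zpow_add_one₀ hc0.ne', mul_comm])⟩
    calc μH[d] (f '' A) = μH[d] (⋃ n, f '' B n) := by rw [← image_iUnion, hBu]
      _ ≤ ∑' n, μH[d] (f '' B n) := measure_iUnion_le _
      _ ≤ ∑' n, ENNReal.ofReal c ^ d * ∫⁻ x in B n, ENNReal.ofReal (h x) ^ d ∂μH[d] :=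
        ENNReal.tsum_le_tsum hB
      _ = _ := by rw [ENNReal.tsum_mul_left, ← lintegral_iUnion hBm hBd, hBu]
  have hlim : Tendsto (fun c : ℝ => ENNReal.ofReal c ^ d *
      ∫⁻ x in A, ENNReal.ofReal (h x) ^ d ∂μH[d]) (𝓝[>] 1)
      (𝓝 (ENNReal.ofReal 1 ^ d * ∫⁻ x in A, ENNReal.ofReal (h x) ^ d ∂μH[d])) := by
    refine ENNReal.Tendsto.mul_const ?_ (Or.inl (by simp))
    exact (ENNReal.continuous_rpow_const.comp ENNReal.continuous_ofReal).continuousWithinAt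
  simpa using ge_of_tendsto hlim (eventually_nhdsWithin_of_forall hshells)

theorem setLIntegral_image_hausdorffMeasure_le (hd : 0 ≤ d) (hA : MeasurableSet A)
    (hfm : Measurable f) (hh : Measurable h) (hpos : ∀ x ∈ A, 0 < h x)
    (hf : ∀ x ∈ A, ∀ y ∈ A, dist (f x) (f y) ^ 2 ≤ h x * h y * dist x y ^ 2)
    {g : Y → ℝ≥0∞} (hg : Measurable g) :
    ∫⁻ y in f '' A, g y ∂μH[d] ≤ ∫⁻ x in A, g (f x) * ENNReal.ofReal (h x) ^ d ∂μH[d] := by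
  have hdensity : Measurable fun x => ENNReal.ofReal (h x) ^ d := by fun_prop
  have hle : (μH[d] : Measure Y).restrict (f '' A) ≤
      (((μH[d] : Measure X).restrict A).withDensity fun x => ENNReal.ofReal (h x) ^ d).map f := by
    refine Measure.le_iff.2 fun B hB => ?_
    rw [Measure.restrict_apply hB, Measure.map_apply hfm hB, withDensity_apply _ (hfm hB),
      Measure.restrict_restrict (hfm hB), inter_comm, ← image_inter_preimage, inter_comm A]
    exact hausdorffMeasure_image_le_lintegral_factor hd ((hfm hB).inter hA) hh
      (fun x hx => hpos x hx.2) fun x hx y hy => hf x hx.2 y hy.2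
  calc ∫⁻ y in f '' A, g y ∂μH[d]
      ≤ ∫⁻ y, g y ∂(((μH[d] : Measure X).restrict A).withDensity
          fun x => ENNReal.ofReal (h x) ^ d).map f := lintegral_mono' hle le_rfl
    _ = ∫⁻ x in A, g (f x) * ENNReal.ofReal (h x) ^ d ∂μH[d] := by
      rw [lintegral_map hg hfm, lintegral_withDensity_eq_lintegral_mul (g := fun x => g (f x)) _
        hdensity (hg.comp hfm)]
      simp only [Pi.mul_apply, mul_comm]

end Hausdorff

section Determinant

variable {U V W : Type*} [NormedAddCommGroup U] [InnerProductSpace ℝ U] [FiniteDimensional ℝ U]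
  [NormedAddCommGroup V] [InnerProductSpace ℝ V] [NormedAddCommGroup W] [InnerProductSpace ℝ W]

theorem normDet_eq_of_norm_apply_eq {f : U →ₗ[ℝ] V} {g : U →ₗ[ℝ] W} (hfg : ∀ x, ‖f x‖ = ‖g x‖) :
    f.normDet = g.normDet := by
  have hinner : ∀ x y, ⟪f x, f y⟫ = ⟪g x, g y⟫ := by
    intro x y
    simp only [real_inner_eq_norm_add_mul_self_sub_norm_mul_self_sub_norm_mul_self_div_two,
      ← map_add, hfg]
  have hgram := f.normDet_sq_eq_det_gram (stdOrthonormalBasis ℝ U)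
  simp only [Matrix.gram, hinner] at hgram
  rw [← sq_eq_sq₀ f.normDet_nonneg g.normDet_nonneg]
  exact_mod_cast hgram.trans (g.normDet_sq_eq_det_gram (stdOrthonormalBasis ℝ U)).symm

theorem abs_det_eq_of_norm_apply_eq {f g : U →ₗ[ℝ] U} (hfg : ∀ x, ‖f x‖ = ‖g x‖) :
    |f.det| = |g.det| := by
  rw [← LinearMap.normDet_eq_abs_det, ← LinearMap.normDet_eq_abs_det,
    normDet_eq_of_norm_apply_eq hfg]

theorem abs_det_eq_pow_of_norm_apply_eq {f : U →ₗ[ℝ] U} {c : ℝ} (hc : 0 ≤ c)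
    (hf : ∀ x, ‖f x‖ = c * ‖x‖) : |f.det| = c ^ finrank ℝ U := by
  have hcompare : ∀ x, ‖f x‖ = ‖(c • LinearMap.id : U →ₗ[ℝ] U) x‖ := fun x => by
    rw [hf, LinearMap.smul_apply, LinearMap.id_apply, norm_smul, Real.norm_of_nonneg hc]
  rw [abs_det_eq_of_norm_apply_eq hcompare, LinearMap.det_smul, LinearMap.det_id, mul_one,
    abs_of_nonneg (by positivity)]

theorem abs_det_eq_pow_of_norm_sq_apply_eq {f : U →ₗ[ℝ] U} {q : U} (hq : ‖q‖ = 1) {c : ℝ}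
    (hc : 0 < c) (hf : ∀ x, ‖f x‖ ^ 2 = ⟪q, x⟫ ^ 2 + c ^ 2 * (‖x‖ ^ 2 - ⟪q, x⟫ ^ 2)) :
    |f.det| = c ^ (finrank ℝ U - 1) := by
  let g : U →ₗ[ℝ] U := c • LinearMap.transvection (((1 - c) / c) • innerₗ U q) q
  have hg : ∀ x, g x = c • x + ((1 - c) * ⟪q, x⟫) • q := fun x => by
    simp only [g, LinearMap.smul_apply, LinearMap.transvection.apply, innerₗ_apply_apply,
      smul_add, smul_smul, smul_eq_mul]
    field_simp
  have hcompare : ∀ x, ‖f x‖ = ‖g x‖ := fun x => by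
    rw [← sq_eq_sq₀ (norm_nonneg _) (norm_nonneg _), hf, hg, norm_add_sq_real, norm_smul,
      norm_smul, inner_smul_left, inner_smul_right, real_inner_comm, hq, mul_pow, mul_pow,
      Real.norm_eq_abs, Real.norm_eq_abs, sq_abs, sq_abs, RCLike.conj_to_real]
    ring
  have hdim : finrank ℝ U - 1 + 1 = finrank ℝ U :=
    have : Nontrivial U := ⟨q, 0, fun h => by simp [h] at hq⟩
    Nat.sub_add_cancel finrank_pos
  have hdet : g.det = c ^ (finrank ℝ U - 1) := by
    rw [LinearMap.det_smul, LinearMap.transvection.det, LinearMap.smul_apply, innerₗ_apply_apply,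
      real_inner_self_eq_norm_sq, hq, ← hdim, pow_succ, Nat.add_sub_cancel, smul_eq_mul]
    field_simp
    ring
  rw [abs_det_eq_of_norm_apply_eq hcompare, hdet, abs_of_nonneg (by positivity)]

theorem MobiusOn.lintegral_image [MeasurableSpace U] [BorelSpace U] {μ : Measure U}
    [μ.IsAddHaarMeasure] {f : U → U} {h : U → ℝ} {s : Set U} (hf : MobiusOn f h s) (hs : IsOpen s)
    (hpos : ∀ x ∈ s, 0 < h x) (hh : ContinuousOn h s) (hdiff : DifferentiableOn ℝ f s)
    (g : U → ℝ≥0∞) :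
    ∫⁻ x in f '' s, g x ∂μ = ∫⁻ x in s, ENNReal.ofReal (h x ^ finrank ℝ U) * g (f x) ∂μ := by
  have hderiv : ∀ x ∈ s, HasFDerivAt f (fderiv ℝ f x) x := fun x hx =>
    (hdiff.differentiableAt (hs.mem_nhds hx)).hasFDerivAt
  rw [lintegral_image_eq_lintegral_abs_det_fderiv_mul μ hs.measurableSet
    (fun x hx => (hderiv x hx).hasFDerivWithinAt) (hf.injOn hpos)]
  refine setLIntegral_congr_fun hs.measurableSet fun x hx => ?_
  have hnorm := hf.norm_fderiv_apply (hs.mem_nhds hx) (hpos x hx).le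
    (hh.continuousAt (hs.mem_nhds hx)) (hderiv x hx)
  have hdet : |(fderiv ℝ f x).det| = h x ^ finrank ℝ U :=
    abs_det_eq_pow_of_norm_apply_eq (hpos x hx).le hnorm
  simp only [hdet]

end Determinant

section Stereographic

variable {E : Type*} [NormedAddCommGroup E] [InnerProductSpace ℝ E] {q : E} (hq : ‖q‖ = 1)

/-- The conformal factor of Mathlib's inverse stereographic projection `stereoInvFun`, which sends
the sphere of radius `2` to the equator. -/
noncomputable def stereoFactor {V : Type*} [NormedAddCommGroup V] (w : V) : ℝ := 4 / (‖w‖ ^ 2 + 4)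

theorem stereoFactor_pos {V : Type*} [NormedAddCommGroup V] (w : V) : 0 < stereoFactor w := by
  unfold stereoFactor
  positivity

@[fun_prop]
theorem continuous_stereoFactor {V : Type*} [NormedAddCommGroup V] :
    Continuous (stereoFactor : V → ℝ) :=
  continuous_const.div (by fun_prop) fun w => by positivity

theorem inner_orthogonal_singleton (w : (ℝ ∙ q)ᗮ) : ⟪q, (w : E)⟫ = 0 :=
  Submodule.mem_orthogonal_singleton_iff_inner_right.1 w.2

theorem mobiusOn_stereoInvFun : MobiusOn (stereoInvFun hq) stereoFactor univ := by
  intro w _ w' _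
  have hunit : ∀ v : (ℝ ∙ q)ᗮ, ‖(stereoInvFun hq v : E)‖ = 1 := fun v =>
    mem_sphere_zero_iff_norm.1 (stereoInvFun hq v).2
  have hw : ⟪(w : E), q⟫ = 0 := by rw [real_inner_comm, inner_orthogonal_singleton]
  rw [Subtype.dist_eq, dist_eq_norm, dist_eq_norm, norm_sub_sq_real, norm_sub_sq_real, hunit, hunit]
  simp only [stereoInvFun_apply, inner_smul_left, inner_smul_right, inner_add_left,
    inner_add_right, hw, inner_orthogonal_singleton, real_inner_self_eq_norm_sq, hq,
    RCLike.conj_to_real, Submodule.coe_inner, stereoFactor]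
  field_simp
  ring

theorem stereoInvFun_injective : Function.Injective (stereoInvFun hq) :=
  injOn_univ.1 ((mobiusOn_stereoInvFun hq).injOn fun w _ => stereoFactor_pos w)

theorem exists_stereoInvFun_eq {x : sphere (0 : E) 1} (hx : (x : E) ≠ q) :
    ∃ w, stereoInvFun hq w = x :=
  ⟨_, stereo_left_inv hq hx⟩

theorem differentiable_coe_stereoInvFun :
    Differentiable ℝ fun w : (ℝ ∙ q)ᗮ => (stereoInvFun hq w : E) :=
  (contDiff_stereoInvFunAux (m := 1) (v := q)).differentiable one_ne_zero |>.comp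
    (ℝ ∙ q)ᗮ.subtypeL.differentiable

end Stereographic

section Cone

variable {E : Type*} [NormedAddCommGroup E] [InnerProductSpace ℝ E] {q : E} (hq : ‖q‖ = 1)

theorem inner_smul_add_orthogonalProjectionOnto (hq : ‖q‖ = 1) (u : E) :
    ⟪q, u⟫ • q + ((ℝ ∙ q)ᗮ.orthogonalProjectionOnto u : E) = u := by
  have hsplit := (ℝ ∙ q).starProjection_add_starProjection_orthogonal u
  rwa [Submodule.starProjection_unit_singleton ℝ hq] at hsplit

theorem norm_orthogonalProjectionOnto_sq (hq : ‖q‖ = 1) (u : E) :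
    ‖(ℝ ∙ q)ᗮ.orthogonalProjectionOnto u‖ ^ 2 = ‖u‖ ^ 2 - ⟪q, u⟫ ^ 2 := by
  have hsplit := congrArg (‖·‖ ^ 2) (inner_smul_add_orthogonalProjectionOnto hq u)
  simp only [norm_add_sq_real, inner_smul_left, inner_orthogonal_singleton, norm_smul, hq, mul_zero,
    add_zero, mul_one, Real.norm_eq_abs, sq_abs, Submodule.coe_norm] at hsplit ⊢
  linarith

/-- The coordinates of a point relative to the axis `ℝ ∙ q`: its height over the hyperplane
`(ℝ ∙ q)ᗮ` and its projection to that hyperplane. -/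
noncomputable def axialSplit (q u : E) : ℝ × (ℝ ∙ q)ᗮ :=
  (⟪q, u⟫, (ℝ ∙ q)ᗮ.orthogonalProjectionOnto u)

/-- The cone over inverse stereographic projection: the height `⟪q, u⟫` of a point `u` over the
hyperplane `(ℝ ∙ q)ᗮ` becomes the radius. -/
noncomputable def stereoCone (u : E) : E :=
  ⟪q, u⟫ • (stereoInvFun hq ((ℝ ∙ q)ᗮ.orthogonalProjectionOnto u) : E)

theorem stereoCone_injOn : InjOn (stereoCone hq) {u | 0 < ⟪q, u⟫} := by
  have hnorm : ∀ u : E, 0 < ⟪q, u⟫ → ‖stereoCone hq u‖ = ⟪q, u⟫ := fun u hu => by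
    rw [stereoCone, norm_smul, Real.norm_of_nonneg hu.le,
      mem_sphere_zero_iff_norm.1 (stereoInvFun hq _).2, mul_one]
  intro u (hu : 0 < ⟪q, u⟫) u' hu' h
  have hheight : ⟪q, u⟫ = ⟪q, u'⟫ := by rw [← hnorm u hu, ← hnorm u' hu', h]
  have hproj : (ℝ ∙ q)ᗮ.orthogonalProjectionOnto u = (ℝ ∙ q)ᗮ.orthogonalProjectionOnto u' := by
    refine stereoInvFun_injective hq (Subtype.ext (smul_right_injective E hu.ne' ?_))
    simpa only [stereoCone, hheight] using h
  rw [← inner_smul_add_orthogonalProjectionOnto hq u, hheight, hproj,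
    inner_smul_add_orthogonalProjectionOnto hq]

theorem differentiable_stereoCone : Differentiable ℝ (stereoCone hq) :=
  (innerSL ℝ q).differentiable.smul
    ((differentiable_coe_stereoInvFun hq).comp (ContinuousLinearMap.differentiable _))

theorem norm_fderiv_stereoCone_sq (u v : E) :
    ‖fderiv ℝ (stereoCone hq) u v‖ ^ 2 = ⟪q, v⟫ ^ 2 +
      (⟪q, u⟫ * stereoFactor ((ℝ ∙ q)ᗮ.orthogonalProjectionOnto u)) ^ 2 *
        (‖v‖ ^ 2 - ⟪q, v⟫ ^ 2) := by
  set P := (ℝ ∙ q)ᗮ.orthogonalProjectionOnto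
  let φ : (ℝ ∙ q)ᗮ → E := fun w => stereoInvFun hq w
  have hφ : HasFDerivAt φ (fderiv ℝ φ (P u)) (P u) :=
    (differentiable_coe_stereoInvFun hq (P u)).hasFDerivAt
  have hunit : ∀ w, ‖φ w‖ ^ 2 = 1 := fun w => by
    rw [mem_sphere_zero_iff_norm.1 (stereoInvFun hq w).2, one_pow]
  have htangent : ⟪fderiv ℝ φ (P u) (P v), φ (P u)⟫ = 0 := by
    have hconst := hφ.norm_sq
    simp only [hunit] at hconst
    have := DFunLike.congr_fun (hconst.unique (hasFDerivAt_const (1 : ℝ) (P u))) (P v)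
    simpa [real_inner_comm] using this
  have hconformal : ‖fderiv ℝ φ (P u) (P v)‖ = stereoFactor (P u) * ‖P v‖ :=
    MobiusOn.norm_fderiv_apply (s := univ) (mobiusOn_stereoInvFun hq) univ_mem
      (stereoFactor_pos _).le continuous_stereoFactor.continuousAt hφ (P v)
  have hcone : fderiv ℝ (stereoCone hq) u v =
      ⟪q, u⟫ • fderiv ℝ φ (P u) (P v) + ⟪q, v⟫ • φ (P u) := by
    have := ((innerSL ℝ q).hasFDerivAt (x := u)).smul (hφ.comp u P.hasFDerivAt)
    have hcone : HasFDerivAt (stereoCone hq) _ u := this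
    rw [hcone.fderiv]
    simp
  rw [hcone, norm_add_sq_real, norm_smul, norm_smul, inner_smul_left, inner_smul_right,
    htangent, hconformal, mul_pow, mul_pow, mul_pow, hunit,
    norm_orthogonalProjectionOnto_sq hq, Real.norm_eq_abs, Real.norm_eq_abs, sq_abs, sq_abs]
  ring

theorem abs_det_fderiv_stereoCone [FiniteDimensional ℝ E] {u : E} (hu : 0 < ⟪q, u⟫) :
    |(fderiv ℝ (stereoCone hq) u).det| =
      (⟪q, u⟫ * stereoFactor ((ℝ ∙ q)ᗮ.orthogonalProjectionOnto u)) ^ (finrank ℝ E - 1) :=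
  abs_det_eq_pow_of_norm_sq_apply_eq hq (mul_pos hu (stereoFactor_pos _))
    (norm_fderiv_stereoCone_sq hq u)

section Volume

open scoped Pointwise

theorem image_stereoCone_subset (T : Set (sphere (0 : E) 1)) :
    stereoCone hq '' (axialSplit q ⁻¹' (Ioo 0 1 ×ˢ (stereoInvFun hq ⁻¹' T))) ⊆
      Ioo (0 : ℝ) 1 • ((↑) '' T) := by
  rintro _ ⟨u, ⟨hheight, hT⟩, rfl⟩
  exact smul_mem_smul hheight (mem_image_of_mem _ hT)

theorem Ioo_smul_subset_image_stereoCone_union (T : Set (sphere (0 : E) 1)) :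
    Ioo (0 : ℝ) 1 • ((↑) '' T) ⊆
      stereoCone hq '' (axialSplit q ⁻¹' (Ioo 0 1 ×ˢ (stereoInvFun hq ⁻¹' T))) ∪
        (ℝ ∙ q : Submodule ℝ E) := by
  rintro _ ⟨r, hr, _, ⟨x, hx, rfl⟩, rfl⟩
  rcases eq_or_ne (x : E) q with hxq | hxq
  · right
    rw [hxq]
    exact Submodule.smul_mem _ r (Submodule.mem_span_singleton_self q)
  left
  obtain ⟨w, rfl⟩ := exists_stereoInvFun_eq hq hxq
  have hheight : ⟪q, r • q + (w : E)⟫ = r := by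
    rw [inner_add_right, inner_smul_right, inner_orthogonal_singleton,
      real_inner_self_eq_norm_sq, hq]
    ring
  have hproj : (ℝ ∙ q)ᗮ.orthogonalProjectionOnto (r • q + w) = w := by
    refine Subtype.ext (add_left_cancel (a := r • q) ?_)
    conv_rhs => rw [← inner_smul_add_orthogonalProjectionOnto hq (r • q + w), hheight]
  refine ⟨r • q + w, ?_, ?_⟩
  · simpa only [mem_preimage, axialSplit, hheight, hproj, mem_prod] using ⟨hr, hx⟩
  · simp only [stereoCone, hheight, hproj]

variable [FiniteDimensional ℝ E] [MeasurableSpace E] [BorelSpace E]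

theorem measurePreserving_axialSplit (hq : ‖q‖ = 1) : MeasurePreserving (axialSplit q) := by
  let ι := LinearIsometryEquiv.toSpanUnitSingleton (𝕜 := ℝ) q hq
  have hprod : MeasurePreserving fun u : E =>
      ((ℝ ∙ q).orthogonalProjectionOnto u, (ℝ ∙ q)ᗮ.orthogonalProjectionOnto u) := by
    convert! (WithLp.volume_preserving_ofLp _ _).comp
      (ℝ ∙ q).orthogonalDecomposition.measurePreserving using 1
    ext u : 1
    simp
  convert! (ι.symm.measurePreserving.prod (MeasurePreserving.id volume)).comp hprod using 1
  ext u : 1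
  refine Prod.ext (ι.injective ?_) rfl
  simp only [Function.comp_apply, Prod.map_fst, LinearIsometryEquiv.apply_symm_apply]
  refine Subtype.ext ?_
  rw [LinearIsometryEquiv.toSpanUnitSingleton_apply]
  exact (Submodule.starProjection_unit_singleton ℝ hq u).symm

theorem lintegral_Ioo_ofReal_pow (n : ℕ) :
    ∫⁻ r in Ioo (0 : ℝ) 1, ENNReal.ofReal (r ^ n) = ((n + 1 : ℕ) : ℝ≥0∞)⁻¹ := by
  rw [Measure.restrict_congr_set Ioo_ae_eq_Ioc, ← ofReal_integral_eq_lintegral_ofReal,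
    ← intervalIntegral.integral_of_le zero_le_one, integral_pow]
  · rw [one_pow, zero_pow n.succ_ne_zero, sub_zero, one_div,
      ENNReal.ofReal_inv_of_pos (by positivity), ← Nat.cast_succ, ENNReal.ofReal_natCast]
  · exact (intervalIntegrable_iff_integrableOn_Ioc_of_le zero_le_one).1
      ((continuous_pow n).intervalIntegrable ..)
  · exact (ae_restrict_mem measurableSet_Ioc).mono fun r hr => pow_nonneg hr.1.le n

theorem volume_Ioo_smul_eq_volume_image_stereoCone (hE : 1 < finrank ℝ E)
    (T : Set (sphere (0 : E) 1)) :
    volume (Ioo (0 : ℝ) 1 • ((↑) '' T : Set E)) =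
      volume (stereoCone hq '' (axialSplit q ⁻¹' (Ioo 0 1 ×ˢ (stereoInvFun hq ⁻¹' T)))) := by
  have haxis : volume ((ℝ ∙ q : Submodule ℝ E) : Set E) = 0 :=
    Measure.addHaar_submodule _ _ fun htop => by
      have := finrank_span_singleton (K := ℝ) (norm_ne_zero_iff.1 (hq.trans_ne one_ne_zero))
      rw [htop, finrank_top] at this
      omega
  refine le_antisymm ?_ (measure_mono (image_stereoCone_subset hq T))
  refine (measure_mono (Ioo_smul_subset_image_stereoCone_union hq T)).trans ?_
  exact (measure_union_le _ _).trans_eq (by rw [haxis, add_zero])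

theorem volume_image_stereoCone {T : Set (sphere (0 : E) 1)} (hT : MeasurableSet T) :
    volume (stereoCone hq '' (axialSplit q ⁻¹' (Ioo 0 1 ×ˢ (stereoInvFun hq ⁻¹' T)))) =
      (finrank ℝ E : ℝ≥0∞)⁻¹ *
        ∫⁻ w in stereoInvFun hq ⁻¹' T, ENNReal.ofReal (stereoFactor w ^ (finrank ℝ E - 1)) := by
  set n := finrank ℝ E - 1
  have hn : n + 1 = finrank ℝ E :=
    have : Nontrivial E := ⟨q, 0, fun h => by simp [h] at hq⟩
    Nat.sub_add_cancel finrank_pos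
  have hsplit := measurePreserving_axialSplit hq
  set S : Set (ℝ × (ℝ ∙ q)ᗮ) := Ioo 0 1 ×ˢ (stereoInvFun hq ⁻¹' T)
  have hS : MeasurableSet S :=
    measurableSet_Ioo.prod ((continuous_stereoInvFun hq).measurable hT)
  rw [← lintegral_abs_det_fderiv_eq_addHaar_image _ (hsplit.measurable hS)
    (fun u _ => (differentiable_stereoCone hq u).hasFDerivAt.hasFDerivWithinAt)
    ((stereoCone_injOn hq).mono fun u hu => hu.1.1)]
  calc ∫⁻ u in axialSplit q ⁻¹' S, ENNReal.ofReal |(fderiv ℝ (stereoCone hq) u).det|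
      = ∫⁻ u in axialSplit q ⁻¹' S,
          ENNReal.ofReal (((axialSplit q u).1 * stereoFactor (axialSplit q u).2) ^ n) :=
        setLIntegral_congr_fun (hsplit.measurable hS) fun u hu => by
          simp only [abs_det_fderiv_stereoCone hq hu.1.1, axialSplit, n]
    _ = ∫⁻ p in S, ENNReal.ofReal ((p.1 * stereoFactor p.2) ^ n) :=
        hsplit.setLIntegral_comp_preimage
          (f := fun p => ENNReal.ofReal ((p.1 * stereoFactor p.2) ^ n)) hS (by fun_prop)
    _ = ∫⁻ p in S, ENNReal.ofReal (p.1 ^ n) * ENNReal.ofReal (stereoFactor p.2 ^ n) :=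
        setLIntegral_congr_fun hS fun p hp => by
          simp only [mul_pow, ENNReal.ofReal_mul (pow_nonneg hp.1.1.le n)]
    _ = (finrank ℝ E : ℝ≥0∞)⁻¹ *
          ∫⁻ w in stereoInvFun hq ⁻¹' T, ENNReal.ofReal (stereoFactor w ^ n) := by
        rw [Measure.volume_eq_prod, ← Measure.prod_restrict,
          lintegral_prod_mul (f := fun r => ENNReal.ofReal (r ^ n))
            (g := fun w => ENNReal.ofReal (stereoFactor w ^ n)) (by fun_prop) (by fun_prop),
          lintegral_Ioo_ofReal_pow, hn]

theorem toSphere_eq_map_stereoInvFun (hE : 1 < finrank ℝ E) :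
    (volume : Measure E).toSphere = (volume.withDensity fun w : (ℝ ∙ q)ᗮ =>
      ENNReal.ofReal (stereoFactor w ^ (finrank ℝ E - 1))).map (stereoInvFun hq) := by
  have hmeas := (continuous_stereoInvFun hq).measurable
  ext T hT
  rw [Measure.toSphere_apply' _ hT, volume_Ioo_smul_eq_volume_image_stereoCone hq hE,
    volume_image_stereoCone hq hT, Measure.map_apply hmeas hT, withDensity_apply _ (hmeas hT),
    ← mul_assoc, ENNReal.mul_inv_cancel (by simp; omega) (ENNReal.natCast_ne_top _), one_mul]

theorem lintegral_toSphere_eq_lintegral_stereoInvFun (hE : 1 < finrank ℝ E)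
    {F : sphere (0 : E) 1 → ℝ≥0∞} (hF : Measurable F) :
    ∫⁻ x, F x ∂(volume : Measure E).toSphere = ∫⁻ w : (ℝ ∙ q)ᗮ,
      ENNReal.ofReal (stereoFactor w ^ (finrank ℝ E - 1)) * F (stereoInvFun hq w) := by
  have hmeas := (continuous_stereoInvFun hq).measurable
  rw [toSphere_eq_map_stereoInvFun hq hE, lintegral_map hF hmeas]
  exact lintegral_withDensity_eq_lintegral_mul _ (by fun_prop) (hF.comp hmeas)

end Volume

end Cone

section OrthonormalBasis

theorem exists_orthonormalBasis_apply_zero_eq {V : Type*} [NormedAddCommGroup V]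
    [InnerProductSpace ℝ V] [FiniteDimensional ℝ V] {n : ℕ} [NeZero n] (hV : finrank ℝ V = n)
    {v : V} (hv : ‖v‖ = 1) : ∃ e : OrthonormalBasis (Fin n) ℝ V, e 0 = v := by
  have hortho : Orthonormal ℝ (({0} : Set (Fin n)).domRestrict fun _ => v) :=
    ⟨fun _ => hv, fun i j hij => (hij (Subsingleton.elim i j)).elim⟩
  obtain ⟨e, he⟩ := hortho.exists_orthonormalBasis_extension_of_card_eq (by simpa using hV)
  exact ⟨e, he 0 rfl⟩

theorem exists_orthonormalBasis_coe_eq_succ {n : ℕ} {E : Type*} [NormedAddCommGroup E]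
    [InnerProductSpace ℝ E] (b : OrthonormalBasis (Fin (n + 1)) ℝ E) :
    ∃ e : OrthonormalBasis (Fin n) ℝ (ℝ ∙ b 0)ᗮ, ∀ i, (e i : E) = b i.succ := by
  have := Fact.mk ((finrank_eq_card_basis b.toBasis).trans (Fintype.card_fin (n + 1)))
  have := b.toBasis.finiteDimensional_of_finite
  have hu := (b.orthonormal.comp Fin.succ (Fin.succ_injective n)).codRestrict (ℝ ∙ b 0)ᗮ fun i =>
    Submodule.mem_orthogonal_singleton_iff_inner_right.2 (b.orthonormal.2 (Fin.succ_ne_zero i).symm)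
  have hdim : finrank ℝ (ℝ ∙ b 0)ᗮ = Fintype.card (Fin n) := by
    rw [Submodule.finrank_orthogonal_span_singleton (n := n) (b.orthonormal.ne_zero 0),
      Fintype.card_fin]
  obtain ⟨e, he⟩ := Orthonormal.exists_orthonormalBasis_extension_of_card_eq (s := univ) hdim
    (hu.comp Subtype.val Subtype.val_injective)
  exact ⟨e, fun i => congrArg Subtype.val (he i (mem_univ i))⟩

end OrthonormalBasis

section Circle

section General

variable {E : Type*} [NormedAddCommGroup E] [InnerProductSpace ℝ E] {q : E} (hq : ‖q‖ = 1)

/-- The circle through `q` which inverse stereographic projection from `q` makes out of the line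
`a + ℝ v`; the point `q` stands for the point at infinity of the line. -/
def stereoLine (a v : (ℝ ∙ q)ᗮ) : Set (sphere (0 : E) 1) :=
  {x | (x : E) = q ∨ ∃ s : ℝ, stereoInvFun hq (a + s • v) = x}

theorem center_orthogonal_of_norm_circle_eq_one {c u v : E} {r : ℝ} (hr : r ≠ 0)
    (hnorm : ∀ t : ℝ, ‖c + r • (Real.cos t • u + Real.sin t • v)‖ = 1) :
    ⟪c, u⟫ = 0 ∧ ⟪c, v⟫ = 0 := by
  have hantipodal : ∀ w : E, ‖c + r • w‖ = 1 → ‖c - r • w‖ = 1 → ⟪c, w⟫ = 0 := by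
    intro w hadd hsub
    have hpolar := norm_sub_sq_real c (r • w)
    rw [hsub, ← hadd, norm_add_sq_real, inner_smul_right] at hpolar
    exact (mul_eq_zero.1 (by linarith : r * ⟪c, w⟫ = 0)).resolve_left hr
  constructor
  · exact hantipodal u (by simpa using hnorm 0) (by simpa [sub_eq_add_neg] using hnorm Real.pi)
  · exact hantipodal v (by simpa using hnorm (Real.pi / 2))
      (by simpa [sub_eq_add_neg] using hnorm (-(Real.pi / 2)))

theorem circle_point_eq_tan_half {c u v : E} (r : ℝ) {t : ℝ} (ht : Real.cos (t / 2) ≠ 0) :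
    c + r • (Real.cos t • u + Real.sin t • v) =
      c - r • u + (2 * r / (1 + Real.tan (t / 2) ^ 2)) • (u + Real.tan (t / 2) • v) := by
  have hsec : 1 + Real.tan (t / 2) ^ 2 = (Real.cos (t / 2) ^ 2)⁻¹ := by
    rw [← Real.inv_one_add_tan_sq ht, inv_inv]
  have hcos : Real.cos t = 2 * Real.cos (t / 2) ^ 2 - 1 := by
    rw [← Real.cos_two_mul, mul_div_cancel₀ t two_ne_zero]
  have hsin : Real.sin t = 2 * Real.cos (t / 2) ^ 2 * Real.tan (t / 2) := by
    conv_lhs => rw [← mul_div_cancel₀ t two_ne_zero, Real.sin_two_mul,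
      ← Real.tan_mul_cos ht]
    ring
  rw [hsec, hcos, hsin, div_inv_eq_mul]
  module

theorem coe_stereoInvFun_eq_add (w : (ℝ ∙ q)ᗮ) :
    (stereoInvFun hq w : E) = q + (4 / (‖w‖ ^ 2 + 4)) • ((w : E) - (2 : ℝ) • q) := by
  rw [stereoInvFun_apply]
  match_scalars <;> field_simp
  ring

theorem coe_stereoInvFun_eq_add_smul {u v : E} {r m : ℝ} (hr : r ≠ 0)
    (huv : Orthonormal ℝ ![u, v]) (hqu : ⟪q, u⟫ = -r) (hqv : ⟪q, v⟫ = 0) {w : (ℝ ∙ q)ᗮ}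
    (hw : (w : E) = (2 : ℝ) • q + (2 / r) • (u + m • v)) :
    (stereoInvFun hq w : E) = q + (2 * r / (1 + m ^ 2)) • (u + m • v) := by
  have hu : ‖u‖ = 1 := huv.1 0
  have hv : ‖v‖ = 1 := huv.1 1
  have huv0 : ⟪u, v⟫ = 0 := huv.2 zero_ne_one
  have hnorm : ‖w‖ ^ 2 + 4 = 4 * (1 + m ^ 2) / r ^ 2 := by
    rw [Submodule.coe_norm, hw, norm_add_sq_real, norm_smul, norm_smul, mul_pow, mul_pow,
      norm_add_sq_real, norm_smul, hq, hu, hv]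
    simp only [inner_smul_left, inner_smul_right, inner_add_right, hqu, hqv, huv0,
      RCLike.conj_to_real, Real.norm_eq_abs, sq_abs, mul_one]
    field_simp
    ring
  have hm : 1 + m ^ 2 ≠ 0 := by positivity
  rw [coe_stereoInvFun_eq_add, hnorm, hw, add_sub_cancel_left, smul_smul]
  congr 2
  field_simp

theorem mem_stereoLine_iff_exists_circle_point {c u v : E} {r : ℝ} (hr : r ≠ 0)
    (huv : Orthonormal ℝ ![u, v]) (hqu : ⟪q, u⟫ = -r) (hqc : q = c - r • u) {a b : (ℝ ∙ q)ᗮ}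
    (ha : (a : E) = (2 : ℝ) • q + (2 / r) • u) (hb : (b : E) = v) {x : sphere (0 : E) 1} :
    x ∈ stereoLine hq a b ↔ ∃ t : ℝ, c + r • (Real.cos t • u + Real.sin t • v) = x := by
  have hline : ∀ s : ℝ, (stereoInvFun hq (a + s • b) : E) =
      c - r • u + (2 * r / (1 + (s * r / 2) ^ 2)) • (u + (s * r / 2) • v) := fun s => by
    rw [← hqc]
    refine coe_stereoInvFun_eq_add_smul hq hr huv hqu (hb ▸ inner_orthogonal_singleton b) ?_
    rw [Submodule.coe_add, Submodule.coe_smul, ha, hb]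
    match_scalars <;> field_simp
  constructor
  · rintro (hx | ⟨s, rfl⟩)
    · exact ⟨Real.pi, by rw [hx, hqc]; simp [sub_eq_add_neg]⟩
    · have hhalf : 2 * Real.arctan (s * r / 2) / 2 = Real.arctan (s * r / 2) := by ring
      refine ⟨2 * Real.arctan (s * r / 2), ?_⟩
      rw [hline, circle_point_eq_tan_half r (by rw [hhalf]; exact (Real.cos_arctan_pos _).ne'),
        hhalf, Real.tan_arctan]
  · rintro ⟨t, ht⟩
    by_cases hhalf : Real.cos (t / 2) = 0
    · have hcos : Real.cos t = -1 := by
        rw [← mul_div_cancel₀ t two_ne_zero, Real.cos_two_mul, hhalf]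
        norm_num
      have hsin : Real.sin t = 0 := by
        rw [← mul_div_cancel₀ t two_ne_zero, Real.sin_two_mul, hhalf, mul_zero]
      left
      rw [← ht, hcos, hsin, hqc]
      module
    · refine Or.inr ⟨2 * Real.tan (t / 2) / r, Subtype.ext ?_⟩
      rw [hline, ← ht, circle_point_eq_tan_half r hhalf]
      field_simp

end General

theorem IsCircle.exists_eq_stereoLine {C : Set S3} (hC : IsCircle C) :
    ∃ (q : EuclideanSpace ℝ (Fin 4)) (hq : ‖q‖ = 1) (a : (ℝ ∙ q)ᗮ)
      (e : OrthonormalBasis (Fin 3) ℝ (ℝ ∙ q)ᗮ), C = stereoLine hq a (e 0) := by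
  obtain ⟨c, u, v, r, hr, huv, hC⟩ := hC
  have hnorm : ∀ t : ℝ, ‖c + r • (Real.cos t • u + Real.sin t • v)‖ = 1 := fun t => by
    obtain ⟨x, -, hx⟩ := hC.ge (mem_range_self t)
    rw [← hx, mem_sphere_zero_iff_norm.1 x.2]
  obtain ⟨hcu, hcv⟩ := center_orthogonal_of_norm_circle_eq_one hr.ne' hnorm
  have hu : ‖u‖ = 1 := huv.1 0
  have huv0 : ⟪u, v⟫ = 0 := huv.2 zero_ne_one
  have hq : ‖c - r • u‖ = 1 := by simpa [sub_eq_add_neg] using hnorm Real.pi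
  have hqu : ⟪c - r • u, u⟫ = -r := by
    rw [inner_sub_left, inner_smul_left, hcu, real_inner_self_eq_norm_sq, hu]
    simp
  have hqv : ⟪c - r • u, v⟫ = 0 := by
    rw [inner_sub_left, inner_smul_left, hcv, huv0]
    simp
  have hqa : ⟪c - r • u, (2 : ℝ) • (c - r • u) + (2 / r) • u⟫ = 0 := by
    rw [inner_add_right, inner_smul_right, inner_smul_right, hqu, real_inner_self_eq_norm_sq, hq]
    field_simp
    ring
  have : Fact (finrank ℝ (EuclideanSpace ℝ (Fin 4)) = 3 + 1) := ⟨by simp⟩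
  obtain ⟨e, he⟩ := exists_orthonormalBasis_apply_zero_eq
    (Submodule.finrank_orthogonal_span_singleton (n := 3)
      (norm_ne_zero_iff.1 (hq.trans_ne one_ne_zero)))
    (v := ⟨v, Submodule.mem_orthogonal_singleton_iff_inner_right.2 hqv⟩) (huv.1 1)
  refine ⟨c - r • u, hq, ⟨_, Submodule.mem_orthogonal_singleton_iff_inner_right.2 hqa⟩, e, ?_⟩
  ext x
  rw [mem_stereoLine_iff_exists_circle_point hq hr.ne' huv hqu rfl rfl (by rw [he]),
    ← Subtype.val_injective.mem_set_image, hC, mem_range]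

end Circle

section Page

theorem lintegral_eq_lintegral_circleMap {F : ℂ → ℝ≥0∞} (hF : Measurable F) :
    ∫⁻ z, F z = ∫⁻ θ in Ioo (-Real.pi) Real.pi, ∫⁻ r in Ioi (0 : ℝ),
      ENNReal.ofReal r * F (circleMap 0 r θ) := by
  have hpolar : ∀ p : ℝ × ℝ, Complex.polarCoord.symm p = circleMap 0 p.1 p.2 := fun p => by
    rw [Complex.polarCoord_symm_apply, circleMap_zero, Complex.exp_mul_I, Complex.ofReal_cos,
      Complex.ofReal_sin]
  rw [← Complex.lintegral_comp_polarCoord_symm, polarCoord_target, Measure.volume_eq_prod,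
    setLIntegral_prod_symm]
  · simp only [hpolar, smul_eq_mul]
  · simp only [hpolar, smul_eq_mul]
    fun_prop

theorem setLIntegral_ball_eq_lintegral_circleMap {F : ℂ → ℝ≥0∞} (hF : Measurable F) :
    ∫⁻ z in ball 0 1, F z = ∫⁻ θ in Ioo (-Real.pi) Real.pi, ∫⁻ t in Ioo (0 : ℝ) 1,
      ENNReal.ofReal t * F (circleMap 0 t θ) := by
  rw [← lintegral_indicator measurableSet_ball,
    lintegral_eq_lintegral_circleMap (hF.indicator measurableSet_ball)]
  refine lintegral_congr fun θ => ?_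
  rw [← Ioi_inter_Iio, inter_comm, ← setLIntegral_indicator measurableSet_Iio]
  refine setLIntegral_congr_fun measurableSet_Ioi fun t (ht : 0 < t) => ?_
  have hball : circleMap 0 t θ ∈ ball (0 : ℂ) 1 ↔ t ∈ Iio 1 := by simp [abs_of_pos ht]
  by_cases h : t ∈ Iio 1 <;> simp only [indicator, hball, h, if_true, if_false, mul_zero]

theorem setLIntegral_upperHalfPlane_eq {F : ℂ → ℝ≥0∞} (hF : Measurable F) :
    ∫⁻ z in {z : ℂ | 0 < z.im}, F z = ∫⁻ x : ℝ, ∫⁻ y in Ioi (0 : ℝ), F ⟨x, y⟩ := by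
  have hset : {z : ℂ | 0 < z.im} = Complex.measurableEquivRealProd ⁻¹' (univ ×ˢ Ioi 0) := by
    ext z
    simp
  have hcoord := Complex.volume_preserving_equiv_real_prod.setLIntegral_comp_preimage_emb
    Complex.measurableEquivRealProd.measurableEmbedding
    (fun p => F (Complex.measurableEquivRealProd.symm p)) (univ ×ˢ Ioi 0)
  simp only [MeasurableEquiv.symm_apply_apply, ← hset] at hcoord
  rw [hcoord, Measure.volume_eq_prod, setLIntegral_prod _ (by fun_prop), Measure.restrict_univ]
  rfl

variable {V : Type*} [NormedAddCommGroup V] [InnerProductSpace ℝ V]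
  (e : OrthonormalBasis (Fin 3) ℝ V) (a : V)

/-- The plane through the line `a + ℝ e 0` at angle `β`, with `a + ℝ e 0` as its real axis. The
upper half-planes of these planes are the pages of an open book with binding `a + ℝ e 0`. -/
noncomputable def page (β : ℝ) (z : ℂ) : V :=
  a + z.re • e 0 + z.im • (Real.cos β • e 1 + Real.sin β • e 2)

theorem page_ofReal (β x : ℝ) : page e a β x = a + x • e 0 := by
  simp [page]

theorem isometry_page (β : ℝ) : Isometry (page e a β) := by
  have horth : ∀ i j, ⟪e i, e j⟫ = if i = j then 1 else 0 := orthonormal_iff_ite.1 e.orthonormal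
  refine Isometry.of_dist_eq fun z w => ?_
  have hsub : page e a β z - page e a β w =
      (z - w).re • e 0 + (z - w).im • (Real.cos β • e 1 + Real.sin β • e 2) := by
    simp only [page, Complex.sub_re, Complex.sub_im]
    module
  rw [dist_eq_norm, dist_eq_norm, ← sq_eq_sq₀ (norm_nonneg _) (norm_nonneg _), hsub,
    norm_add_sq_real, norm_smul, norm_smul, mul_pow, mul_pow, norm_add_sq_real, norm_smul,
    norm_smul, Complex.sq_norm, Complex.normSq_apply]
  simp only [e.norm_eq_one, inner_add_right, inner_smul_left, inner_smul_right, horth,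
    Real.norm_eq_abs, sq_abs, mul_one, Fin.reduceEq, if_false, mul_zero, add_zero]
  linear_combination (z - w).im ^ 2 * Real.sin_sq_add_cos_sq β

variable [FiniteDimensional ℝ V] [MeasurableSpace V] [BorelSpace V]

theorem measurePreserving_axis_add_plane :
    MeasurePreserving fun p : ℝ × ℂ => a + (p.1 • e 0 + p.2.re • e 1 + p.2.im • e 2) := by
  have hcoord : (fun p : ℝ × ℂ => a + (p.1 • e 0 + p.2.re • e 1 + p.2.im • e 2)) =
      (fun w => a + w) ∘ e.repr.symm ∘ WithLp.toLp 2 ∘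
        (MeasurableEquiv.piFinSuccAbove (fun _ : Fin 3 => ℝ) 0).symm ∘
          Prod.map id Complex.measurableEquivPi := by
    ext p : 1
    simp only [Function.comp_apply, ← e.sum_repr_symm, Fin.sum_univ_three]
    rfl
  rw [hcoord]
  exact (measurePreserving_add_left volume a).comp <| e.measurePreserving_repr_symm.comp <|
    (PiLp.volume_preserving_toLp (Fin 3)).comp <|
    (volume_preserving_piFinSuccAbove (fun _ : Fin 3 => ℝ) 0).symm.comp <|
    (MeasurePreserving.id (volume : Measure ℝ)).prod Complex.volume_preserving_equiv_pi

theorem lintegral_eq_lintegral_page {G : V → ℝ≥0∞} (hG : Measurable G) :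
    ∫⁻ w, G w = ∫⁻ β in Ioo (-Real.pi) Real.pi, ∫⁻ z in {z : ℂ | 0 < z.im},
      ENNReal.ofReal z.im * G (page e a β z) := by
  calc ∫⁻ w, G w = ∫⁻ x : ℝ, ∫⁻ w : ℂ, G (a + (x • e 0 + w.re • e 1 + w.im • e 2)) := by
        rw [← (measurePreserving_axis_add_plane e a).lintegral_comp hG, Measure.volume_eq_prod,
          lintegral_prod _ (by fun_prop)]
    _ = ∫⁻ x : ℝ, ∫⁻ β in Ioo (-Real.pi) Real.pi, ∫⁻ y in Ioi (0 : ℝ),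
          ENNReal.ofReal y * G (page e a β ⟨x, y⟩) := by
      refine lintegral_congr fun x => ?_
      rw [lintegral_eq_lintegral_circleMap (by fun_prop)]
      simp only [page, circleMap_zero_re, circleMap_zero_im, mul_smul, smul_add, add_assoc]
    _ = ∫⁻ β in Ioo (-Real.pi) Real.pi, ∫⁻ x : ℝ, ∫⁻ y in Ioi (0 : ℝ),
          ENNReal.ofReal y * G (page e a β ⟨x, y⟩) := by
      refine lintegral_lintegral_swap (Measurable.aemeasurable ?_)
      refine Measurable.lintegral_prod_right' (f := fun p : (ℝ × ℝ) × ℝ =>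
        ENNReal.ofReal p.2 * G (page e a p.1.2 ⟨p.1.1, p.2⟩)) ?_
      unfold page
      fun_prop
    _ = _ := by
      refine lintegral_congr fun β => ?_
      rw [setLIntegral_upperHalfPlane_eq]
      unfold page
      fun_prop

end Page

section Cayley

open ComplexConjugate

/-- The Möbius transformation that sends `0`, `∞`, `-1` to `p`, `conj p`, `∞`. If `p` lies in the
upper half-plane, then it maps the unit disc onto the upper half-plane, and the radii of the disc
to the hyperbolic rays that emanate from `p`. -/
noncomputable def cayley (p w : ℂ) : ℂ := (p + conj p * w) / (1 + w)

/-- The conformal factor of `cayley p`, when `p` lies in the upper half-plane. -/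
noncomputable def cayleyFactor (p w : ℂ) : ℝ := 2 * p.im / Complex.normSq (1 + w)

@[fun_prop]
theorem measurable_cayley (p : ℂ) : Measurable (cayley p) := by
  unfold cayley
  fun_prop

@[fun_prop]
theorem measurable_cayleyFactor (p : ℂ) : Measurable (cayleyFactor p) := by
  unfold cayleyFactor
  fun_prop

theorem mobiusOn_cayley (p : ℂ) : MobiusOn (cayley p) (cayleyFactor p) {w | 1 + w ≠ 0} := by
  intro v (hv : 1 + v ≠ 0) w (hw : 1 + w ≠ 0)
  have hsub : cayley p v - cayley p w = (conj p - p) * (v - w) / ((1 + v) * (1 + w)) := by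
    unfold cayley
    field_simp
    ring
  have himag : Complex.normSq (conj p - p) = (2 * p.im) ^ 2 := by
    simp only [Complex.normSq_apply, Complex.sub_re, Complex.conj_re, sub_self, mul_zero,
      Complex.sub_im, Complex.conj_im, zero_add]
    ring
  rw [dist_eq_norm, dist_eq_norm, hsub, Complex.sq_norm, Complex.sq_norm, Complex.normSq_div,
    Complex.normSq_mul, Complex.normSq_mul, himag, cayleyFactor, cayleyFactor]
  ring

theorem one_add_ne_zero_of_mem_ball {w : ℂ} (hw : w ∈ ball (0 : ℂ) 1) : 1 + w ≠ 0 := by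
  intro h
  simp [← add_eq_zero_iff_neg_eq.1 h] at hw

theorem cayleyFactor_pos {p w : ℂ} (hp : 0 < p.im) (hw : 1 + w ≠ 0) : 0 < cayleyFactor p w :=
  div_pos (by positivity) (Complex.normSq_pos.2 hw)

theorem im_cayley (p w : ℂ) : (cayley p w).im = cayleyFactor p w * ((1 - ‖w‖ ^ 2) / 2) := by
  rw [cayley, cayleyFactor, Complex.div_im, Complex.sq_norm]
  simp only [Complex.add_im, Complex.mul_im, Complex.conj_re, Complex.conj_im, neg_mul,
    Complex.add_re, Complex.one_re, Complex.normSq_apply, Complex.one_im, zero_add, Complex.mul_re,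
    sub_neg_eq_add]
  ring

theorem cayley_image_ball {p : ℂ} (hp : 0 < p.im) :
    cayley p '' ball 0 1 = {z : ℂ | 0 < z.im} := by
  ext z
  constructor
  · rintro ⟨w, hw, rfl⟩
    have hw1 : ‖w‖ ^ 2 < 1 := (sq_lt_one_iff₀ (norm_nonneg w)).2 (mem_ball_zero_iff.1 hw)
    change 0 < (cayley p w).im
    rw [im_cayley]
    exact mul_pos (cayleyFactor_pos hp (one_add_ne_zero_of_mem_ball hw)) (by linarith)
  · intro (hz : 0 < z.im)
    have hne : ∀ u : ℂ, 0 < u.im → u - conj p ≠ 0 := fun u hu h => by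
      have him : 0 < (u - conj p).im := by
        rw [Complex.sub_im, Complex.conj_im, sub_neg_eq_add]
        positivity
      exact him.ne' (by rw [h, Complex.zero_im])
    have hzp := hne z hz
    refine ⟨(p - z) / (z - conj p), ?_, ?_⟩
    · rw [mem_ball_zero_iff, norm_div, div_lt_one (norm_pos_iff.2 hzp), ← sq_lt_sq₀ (norm_nonneg _)
        (norm_nonneg _), Complex.sq_norm, Complex.sq_norm, Complex.normSq_apply,
        Complex.normSq_apply]
      simp only [Complex.sub_re, Complex.sub_im, Complex.conj_re, Complex.conj_im, sub_neg_eq_add]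
      nlinarith [mul_pos hp hz]
    · have hpp := hne p hp
      have hsum : 1 + (p - z) / (z - conj p) = (p - conj p) / (z - conj p) := by
        field_simp
        ring
      rw [cayley, hsum]
      field_simp
      ring

theorem setLIntegral_upperHalfPlane_eq_lintegral_cayley {p : ℂ} (hp : 0 < p.im) {F : ℂ → ℝ≥0∞}
    (hF : Measurable F) :
    ∫⁻ z in {z : ℂ | 0 < z.im}, F z = ∫⁻ θ in Ioo (-Real.pi) Real.pi, ∫⁻ t in Ioo (0 : ℝ) 1,
      ENNReal.ofReal (t * cayleyFactor p (circleMap 0 t θ) ^ 2) *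
        F (cayley p (circleMap 0 t θ)) := by
  have hdiff : DifferentiableOn ℝ (cayley p) (ball 0 1) := fun w hw =>
    (DifferentiableAt.fun_div (𝕜 := ℂ) (by fun_prop) (by fun_prop)
      (one_add_ne_zero_of_mem_ball hw)).differentiableWithinAt.restrictScalars ℝ
  have hcont : ContinuousOn (cayleyFactor p) (ball 0 1) :=
    continuousOn_const.div (Complex.continuous_normSq.comp (by fun_prop)).continuousOn
      fun w hw => (Complex.normSq_pos.2 (one_add_ne_zero_of_mem_ball hw)).ne'
  rw [← cayley_image_ball hp, ((mobiusOn_cayley p).mono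
    fun w => one_add_ne_zero_of_mem_ball).lintegral_image isOpen_ball
    (fun w hw => cayleyFactor_pos hp (one_add_ne_zero_of_mem_ball hw)) hcont hdiff,
    Complex.finrank_real_complex, setLIntegral_ball_eq_lintegral_circleMap (by fun_prop)]
  refine lintegral_congr fun θ => setLIntegral_congr_fun measurableSet_Ioo fun t ht => ?_
  rw [ENNReal.ofReal_mul ht.1.le, mul_assoc]

end Cayley

section Ray

theorem isometry_circleMap_radius (c : ℂ) (θ : ℝ) : Isometry fun t => circleMap c t θ := by
  refine Isometry.of_dist_eq fun s t => ?_
  rw [circleMap, circleMap, dist_add_left, dist_eq_norm, ← sub_mul, norm_mul,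
    Complex.norm_exp_ofReal_mul_I, mul_one, ← Complex.ofReal_sub, Complex.norm_real, dist_eq_norm]

@[fun_prop]
theorem continuous_circleMap_radius (c : ℂ) (θ : ℝ) : Continuous fun t : ℝ => circleMap c t θ :=
  (isometry_circleMap_radius c θ).continuous

theorem one_add_circleMap_ne_zero {θ t : ℝ} (hθ : θ ∈ Ioo (-Real.pi) Real.pi)
    (ht : t ∈ Icc (0 : ℝ) 1) : 1 + circleMap 0 t θ ≠ 0 := by
  have hcos : -1 < Real.cos θ := by
    have hhalf := Real.cos_pos_of_mem_Ioo (x := θ / 2) ⟨by linarith [hθ.1], by linarith [hθ.2]⟩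
    rw [← mul_div_cancel₀ θ two_ne_zero, Real.cos_two_mul]
    linarith [sq_pos_of_pos hhalf]
  have hre : 0 < (1 + circleMap 0 t θ).re := by
    rw [Complex.add_re, Complex.one_re, circleMap_zero_re]
    rcases eq_or_lt_of_le ht.1 with rfl | htpos
    · norm_num
    · nlinarith [ht.2]
  exact fun h => hre.ne' (by rw [h, Complex.zero_re])

variable {E : Type*} [NormedAddCommGroup E] [InnerProductSpace ℝ E] {q : E} (hq : ‖q‖ = 1)
  (e : OrthonormalBasis (Fin 3) ℝ (ℝ ∙ q)ᗮ) (a : (ℝ ∙ q)ᗮ) (β : ℝ) (p : ℂ) (θ : ℝ)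

/-- The image under inverse stereographic projection of the hyperbolic ray in the page at angle `β`
that emanates from `p` in the direction `θ`; it is parametrized by the radii of the disc model and
reaches the binding for `t = 1`. -/
noncomputable def ray (t : ℝ) : sphere (0 : E) 1 :=
  stereoInvFun hq (page e a β (cayley p (circleMap 0 t θ)))

/-- The speed of `ray`. -/
noncomputable def raySpeed (t : ℝ) : ℝ :=
  stereoFactor (page e a β (cayley p (circleMap 0 t θ))) * cayleyFactor p (circleMap 0 t θ)

/-- The weight of the cubed speed in the volume element of the sphere in ray coordinates. -/
noncomputable def rayWeight (t : ℝ) : ℝ := t * (1 - t ^ 2) / 2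

variable {θ}

theorem mobiusOn_ray (hθ : θ ∈ Ioo (-Real.pi) Real.pi) :
    MobiusOn (ray hq e a β p θ) (raySpeed e a β p θ) (Icc 0 1) := by
  have hdisc : MobiusOn (fun t => circleMap 0 t θ) (fun _ => 1) (Icc 0 1) :=
    .of_isometry (isometry_circleMap_radius 0 θ)
  have hpage : MobiusOn (page e a β) (fun _ => 1) univ := .of_isometry (isometry_page e a β)
  have hray := (mobiusOn_stereoInvFun hq).comp (hpage.comp ((mobiusOn_cayley p).comp hdisc
    fun t ht => one_add_circleMap_ne_zero hθ ht) fun _ _ => mem_univ _) fun _ _ => mem_univ _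
  simp only [one_mul, mul_one] at hray
  exact hray

variable {p} in
theorem raySpeed_pos (hp : 0 < p.im) (hθ : θ ∈ Ioo (-Real.pi) Real.pi) {t : ℝ}
    (ht : t ∈ Icc (0 : ℝ) 1) : 0 < raySpeed e a β p θ t :=
  mul_pos (stereoFactor_pos _) (cayleyFactor_pos hp (one_add_circleMap_ne_zero hθ ht))

variable (θ) in
@[fun_prop]
theorem measurable_raySpeed : Measurable (raySpeed e a β p θ) := by
  have hfactor : Continuous fun z => stereoFactor (page e a β z) :=
    continuous_stereoFactor.comp (isometry_page e a β).continuous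
  exact (hfactor.measurable.comp (by fun_prop)).mul (by fun_prop)

variable (θ) in
theorem ray_one_mem_stereoLine : ray hq e a β p θ 1 ∈ stereoLine hq a (e 0) := by
  have him : (cayley p (circleMap 0 1 θ)).im = 0 := by
    rw [im_cayley, norm_circleMap_zero]
    norm_num
  refine Or.inr ⟨(cayley p (circleMap 0 1 θ)).re, ?_⟩
  rw [ray, page, him, zero_smul, add_zero]

theorem ray_zero : ray hq e a β p θ 0 = stereoInvFun hq (page e a β p) := by
  simp [ray, cayley]

theorem continuousOn_ray (hθ : θ ∈ Ioo (-Real.pi) Real.pi) :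
    ContinuousOn (ray hq e a β p θ) (Icc 0 1) := by
  have hstereo : Continuous (stereoInvFun hq) := continuous_stereoInvFun hq
  exact (hstereo.comp (isometry_page e a β).continuous).comp_continuousOn
    (ContinuousOn.div (by fun_prop) (by fun_prop) fun t ht => one_add_circleMap_ne_zero hθ ht)

variable [MeasurableSpace E] [BorelSpace E]

variable (θ) in
theorem measurable_ray : Measurable (ray hq e a β p θ) := by
  have hstereo : Continuous (stereoInvFun hq) := continuous_stereoInvFun hq
  have hpage := (isometry_page e a β).continuous
  unfold ray
  fun_prop

variable [FiniteDimensional ℝ E]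

theorem lintegral_toSphere_eq_lintegral_ray {F : sphere (0 : E) 1 → ℝ≥0∞} (hF : Measurable F)
    {p : ℝ → ℂ} (hp : ∀ β, 0 < (p β).im) :
    ∫⁻ x, F x ∂(volume : Measure E).toSphere =
      ∫⁻ β in Ioo (-Real.pi) Real.pi, ∫⁻ θ in Ioo (-Real.pi) Real.pi, ∫⁻ t in Ioo (0 : ℝ) 1,
        F (ray hq e a β (p β) θ t) *
          ENNReal.ofReal (raySpeed e a β (p β) θ t ^ 3 * rayWeight t) := by
  have hE : finrank ℝ E = 4 := by
    rw [← (ℝ ∙ q).finrank_add_finrank_orthogonal, finrank_eq_card_basis e.toBasis,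
      finrank_span_singleton (norm_ne_zero_iff.1 (hq.trans_ne one_ne_zero)), Fintype.card_fin]
  have hstereo : Continuous (stereoInvFun hq) := continuous_stereoInvFun hq
  have hpage : ∀ β, Measurable (page e a β) := fun β => (isometry_page e a β).continuous.measurable
  rw [lintegral_toSphere_eq_lintegral_stereoInvFun hq (by omega) hF, hE,
    lintegral_eq_lintegral_page e a (by fun_prop)]
  refine lintegral_congr fun β => ?_
  rw [setLIntegral_upperHalfPlane_eq_lintegral_cayley (hp β) (by fun_prop)]
  refine setLIntegral_congr_fun measurableSet_Ioo fun θ hθ =>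
    setLIntegral_congr_fun measurableSet_Ioo fun t ht => ?_
  have hfactor := cayleyFactor_pos (hp β) (one_add_circleMap_ne_zero hθ (Ioo_subset_Icc_self ht))
  have := stereoFactor_pos (page e a β (cayley (p β) (circleMap 0 t θ)))
  rw [im_cayley, norm_circleMap_zero, sq_abs]
  have hheight : 0 ≤ (1 - t ^ 2) / 2 := by nlinarith [ht.1, ht.2]
  have htpos := ht.1
  rw [← mul_assoc (ENNReal.ofReal _) (ENNReal.ofReal _) (F _), ← mul_assoc, mul_comm,
    ← ENNReal.ofReal_mul (by positivity), ← ENNReal.ofReal_mul (by positivity), ray, raySpeed,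
    rayWeight]
  congr 2
  ring

end Ray

section Linking

theorem nullhomotopicIn_of_comp_eq_coe {A U : Set S3} {X : Type*} [TopologicalSpace X]
    [ContractibleSpace X] (f : C(A, X)) (g : C(X, S3)) (hg : ∀ x, g x ∈ U)
    (hgf : ∀ x, g (f x) = x) : NullhomotopicIn A U := by
  have hnull := ((id_nullhomotopic X).comp_left f).comp_right
    (⟨fun x => ⟨g x, hg x⟩, by fun_prop⟩ : C(X, U))
  refine ⟨fun x hx => mem_of_eq_of_mem (hgf ⟨x, hx⟩).symm (hg _), ?_⟩
  convert hnull using 1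
  ext x : 2
  exact (hgf x).symm

theorem starConvex_compl_page {V : Type*} [NormedAddCommGroup V] [InnerProductSpace ℝ V]
    (e : OrthonormalBasis (Fin 3) ℝ V) (a : V) (β : ℝ) :
    StarConvex ℝ (page e a β (-Complex.I)) (page e a β '' {z | 0 ≤ z.im})ᶜ := by
  rintro w hw s t hs ht hst ⟨z, hz : 0 ≤ z.im, hzw⟩
  rcases eq_or_ne t 0 with rfl | ht0
  · rw [add_zero] at hst
    rw [hst, one_smul, zero_smul, add_zero] at hzw
    have him := congrArg Complex.im ((isometry_page e a β).injective hzw)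
    rw [Complex.neg_im, Complex.I_im] at him
    linarith
  · refine hw ⟨t⁻¹ • (z + s • Complex.I), ?_, ?_⟩
    · change 0 ≤ (t⁻¹ • (z + s • Complex.I)).im
      simp only [Complex.smul_im, Complex.add_im, Complex.I_im, smul_eq_mul, mul_one]
      positivity
    · refine smul_right_injective V ht0 ?_
      change t • page e a β _ = t • w
      rw [← add_right_inj (s • page e a β (-Complex.I)), ← hzw, eq_sub_of_add_eq hst]
      simp only [page, Complex.add_re, Complex.add_im, Complex.smul_re, Complex.smul_im,
        Complex.neg_re, Complex.neg_im, Complex.I_re, Complex.I_im, smul_eq_mul, neg_zero,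
        mul_zero, mul_one, add_zero]
      match_scalars <;> field_simp <;> ring

theorem exists_page_mem_of_not_nullhomotopicIn {q : EuclideanSpace ℝ (Fin 4)} (hq : ‖q‖ = 1)
    (e : OrthonormalBasis (Fin 3) ℝ (ℝ ∙ q)ᗮ) (a : (ℝ ∙ q)ᗮ) (β : ℝ) {D : Set S3}
    (hsub : D ⊆ (stereoLine hq a (e 0))ᶜ) (hD : ¬ NullhomotopicIn D (stereoLine hq a (e 0))ᶜ) :
    ∃ z : ℂ, 0 < z.im ∧ stereoInvFun hq (page e a β z) ∈ D := by
  by_contra! hdisj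
  let P : Set (ℝ ∙ q)ᗮ := page e a β '' {z | 0 ≤ z.im}
  have hcontr : ContractibleSpace ↑Pᶜ := by
    refine (starConvex_compl_page e a β).contractibleSpace ⟨page e a β (-Complex.I), ?_⟩
    rintro ⟨z, hz : 0 ≤ z.im, hzI⟩
    rw [(isometry_page e a β).injective hzI, Complex.neg_im, Complex.I_im] at hz
    linarith
  have hpole : ∀ x : D, x.1 ∈ (stereographic hq).source := fun x hx =>
    hsub x.2 (Or.inl (congrArg Subtype.val hx))
  have hinv : ∀ x : D, stereoInvFun hq (stereographic hq x) = x := fun x =>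
    (stereographic hq).left_inv (hpole x)
  have hmaps : ∀ x : D, stereographic hq x ∈ Pᶜ := by
    rintro x ⟨z, hz : 0 ≤ z.im, hzx⟩
    have hzD : stereoInvFun hq (page e a β z) ∈ D := by
      rw [hzx, hinv]
      exact x.2
    rcases eq_or_lt_of_le hz with him | him
    · refine hsub hzD (Or.inr ⟨z.re, ?_⟩)
      rw [← page_ofReal e a β, Complex.ext (z := z.re) (w := z) rfl him]
    · exact hdisj z him hzD
  refine hD (nullhomotopicIn_of_comp_eq_coe (X := ↑Pᶜ)
    ⟨fun x => ⟨stereographic hq x, hmaps x⟩, ?_⟩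
    ⟨fun w => stereoInvFun hq w, (continuous_stereoInvFun hq).comp continuous_subtype_val⟩ ?_ hinv)
  · exact Continuous.subtype_mk ((stereographic hq).continuousOn.comp_continuous
      continuous_subtype_val hpole) _
  · rintro ⟨w, hw⟩ (hpole' | ⟨s, hs⟩)
    · exact stereoInvFun_ne_north_pole hq w (Subtype.ext hpole')
    · refine hw ⟨s, (Complex.ofReal_im s).ge, ?_⟩
      rw [page_ofReal]
      exact stereoInvFun_injective hq hs

end Linking

section LowerBound

theorem lintegral_rpow_le_lintegral_rpow_mul_mul_lintegral_rpow_neg {α : Type*}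
    [MeasurableSpace α] {μ : Measure α} {r : ℝ} (hr : 1 < r) {g w : α → ℝ≥0∞}
    (hg : AEMeasurable g μ) (hw : AEMeasurable w μ) (hw0 : ∀ᵐ x ∂μ, w x ≠ 0)
    (hwtop : ∀ᵐ x ∂μ, w x ≠ ∞) :
    (∫⁻ x, g x ∂μ) ^ r ≤
      (∫⁻ x, g x ^ r * w x ∂μ) * (∫⁻ x, w x ^ (-(r - 1)⁻¹) ∂μ) ^ (r - 1) := by
  have hr0 : r ≠ 0 := by positivity
  have hr1 : r - 1 ≠ 0 := by linarith
  have hholder := ENNReal.lintegral_mul_le_Lp_mul_Lq μ (Real.HolderConjugate.conjExponent hr)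
    (hg.mul (hw.pow_const r⁻¹)) (hw.pow_const (-r⁻¹))
  have hprod : ∫⁻ x, ((fun x => g x * w x ^ r⁻¹) * fun x => w x ^ (-r⁻¹)) x ∂μ = ∫⁻ x, g x ∂μ := by
    refine lintegral_congr_ae ?_
    filter_upwards [hw0, hwtop] with x hx0 hxtop
    rw [Pi.mul_apply, mul_assoc, ← ENNReal.rpow_add _ _ hx0 hxtop, add_neg_cancel,
      ENNReal.rpow_zero, mul_one]
  have hleft : ∀ x, (g x * w x ^ r⁻¹) ^ r = g x ^ r * w x := fun x => by
    rw [ENNReal.mul_rpow_of_nonneg _ _ (by positivity), ENNReal.rpow_inv_rpow hr0]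
  have hright : ∀ x, (w x ^ (-r⁻¹)) ^ (r.conjExponent) = w x ^ (-(r - 1)⁻¹) := fun x => by
    rw [← ENNReal.rpow_mul, Real.conjExponent]
    congr 1
    field_simp
  change ∫⁻ x, ((fun x => g x * w x ^ r⁻¹) * fun x => w x ^ (-r⁻¹)) x ∂μ ≤
    (∫⁻ x, (g x * w x ^ r⁻¹) ^ r ∂μ) ^ (1 / r) * _ at hholder
  simp only [hprod, hleft, hright] at hholder
  refine (ENNReal.rpow_le_rpow hholder (by positivity)).trans_eq ?_
  rw [ENNReal.mul_rpow_of_nonneg _ _ (by positivity), one_div, ENNReal.rpow_inv_rpow hr0,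
    ← ENNReal.rpow_mul, Real.conjExponent]
  congr 2
  field_simp

/-- The length of each ray for the density `rayWeight ^ (-1/2) / raySpeed`, the case of equality in
Hölder's inequality. Division by it normalizes the extremal density. -/
noncomputable def rayLength : ℝ≥0∞ :=
  ∫⁻ t in Ioo (0 : ℝ) 1, ENNReal.ofReal (rayWeight t) ^ (-2⁻¹ : ℝ)

theorem rayWeight_pos {t : ℝ} (ht : t ∈ Ioo (0 : ℝ) 1) : 0 < rayWeight t := by
  have hsq : 0 < 1 - t ^ 2 := by nlinarith [ht.1, ht.2]
  exact div_pos (mul_pos ht.1 hsq) two_pos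

@[fun_prop]
theorem measurable_rayWeight : Measurable rayWeight := by
  unfold rayWeight
  fun_prop

theorem inv_sq_rayLength_le {g : ℝ → ℝ≥0∞} (hg : Measurable g)
    (h : 1 ≤ ∫⁻ t in Ioo (0 : ℝ) 1, g t) :
    (rayLength ^ 2)⁻¹ ≤ ∫⁻ t in Ioo (0 : ℝ) 1, g t ^ (3 : ℝ) * ENNReal.ofReal (rayWeight t) := by
  have hholder := lintegral_rpow_le_lintegral_rpow_mul_mul_lintegral_rpow_neg
    (μ := volume.restrict (Ioo (0 : ℝ) 1)) (r := 3) (w := fun t => ENNReal.ofReal (rayWeight t))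
    (by norm_num) hg.aemeasurable (by fun_prop)
    (ae_restrict_of_forall_mem measurableSet_Ioo fun t ht =>
      (ENNReal.ofReal_pos.2 (rayWeight_pos ht)).ne')
    (ae_of_all _ fun t => ENNReal.ofReal_ne_top)
  rw [show (3 : ℝ) - 1 = 2 by norm_num, ENNReal.rpow_two] at hholder
  rw [← one_div]
  exact ENNReal.div_le_of_le_mul ((ENNReal.one_le_rpow h three_pos).trans hholder)

theorem one_le_lintegral_ray {q : EuclideanSpace ℝ (Fin 4)} (hq : ‖q‖ = 1)
    (e : OrthonormalBasis (Fin 3) ℝ (ℝ ∙ q)ᗮ) (a : (ℝ ∙ q)ᗮ) {β : ℝ} {p : ℂ} (hp : 0 < p.im)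
    {D : Set S3} (hpD : stereoInvFun hq (page e a β p) ∈ D) {θ : ℝ}
    (hθ : θ ∈ Ioo (-Real.pi) Real.pi) {ρ : S3 → ℝ≥0∞}
    (hρ : ρ ∈ Admissible (connectingPaths (stereoLine hq a (e 0)) D)) :
    1 ≤ ∫⁻ t in Ioo (0 : ℝ) 1, ρ (ray hq e a β p θ t) *
      ENNReal.ofReal (raySpeed e a β p θ t) := by
  let γ : C(I, S3) := ⟨fun s => ray hq e a β p θ (unitInterval.symm s),
    (continuousOn_ray hq e a β p hθ).comp_continuous (by fun_prop) fun s => Subtype.prop _⟩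
  have hγ : γ ∈ connectingPaths (stereoLine hq a (e 0)) D := by
    refine ⟨?_, ?_⟩
    · simpa [γ] using ray_one_mem_stereoLine hq e a β p θ
    · simpa [γ, ray_zero] using hpD
  have hrange : range γ = ray hq e a β p θ '' Icc 0 1 := by
    rw [image_eq_range]
    exact unitInterval.symm_bijective.surjective.range_comp fun s : I => ray hq e a β p θ s
  calc 1 ≤ ∫⁻ x in ray hq e a β p θ '' Icc 0 1, ρ x ∂μH[1] := hrange ▸ hρ.2 γ hγ
    _ ≤ ∫⁻ t in Icc (0 : ℝ) 1, ρ (ray hq e a β p θ t) *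
        ENNReal.ofReal (raySpeed e a β p θ t) ^ (1 : ℝ) ∂μH[1] :=
      setLIntegral_image_hausdorffMeasure_le zero_le_one measurableSet_Icc
        (measurable_ray hq e a β p θ) (measurable_raySpeed e a β p θ)
        (fun t => raySpeed_pos e a β hp hθ)
        (fun s hs t ht => (mobiusOn_ray hq e a β p hθ hs ht).le) hρ.1
    _ = _ := by
      rw [hausdorffMeasure_real, ← Measure.restrict_congr_set Ioo_ae_eq_Icc]
      simp only [ENNReal.rpow_one]

theorem sq_two_pi_mul_inv_sq_rayLength_le_pathModulus {C D : Set S3} (hC : IsCircle C)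
    (hsub : D ⊆ Cᶜ) (hD : ¬ NullhomotopicIn D Cᶜ) :
    ENNReal.ofReal (2 * Real.pi) ^ 2 * (rayLength ^ 2)⁻¹ ≤ pathModulus 3 (connectingPaths C D) := by
  obtain ⟨q, hq, a, e, rfl⟩ := hC.exists_eq_stereoLine
  choose p hp hpD using fun β => exists_page_mem_of_not_nullhomotopicIn hq e a β hsub hD
  refine le_iInf₂ fun ρ hρ => ?_
  have hmeas := hρ.1
  calc ENNReal.ofReal (2 * Real.pi) ^ 2 * (rayLength ^ 2)⁻¹
      = ∫⁻ _ in Ioo (-Real.pi) Real.pi, ∫⁻ _ in Ioo (-Real.pi) Real.pi, (rayLength ^ 2)⁻¹ := by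
        simp only [setLIntegral_const, Real.volume_Ioo, sub_neg_eq_add, ← two_mul]
        ring
    _ ≤ ∫⁻ β in Ioo (-Real.pi) Real.pi, ∫⁻ θ in Ioo (-Real.pi) Real.pi, ∫⁻ t in Ioo (0 : ℝ) 1,
          (ρ (ray hq e a β (p β) θ t) * ENNReal.ofReal (raySpeed e a β (p β) θ t)) ^ (3 : ℝ) *
            ENNReal.ofReal (rayWeight t) := by
        refine lintegral_mono fun β => setLIntegral_mono' measurableSet_Ioo fun θ hθ => ?_
        refine inv_sq_rayLength_le ?_ (one_le_lintegral_ray hq e a (hp β) (hpD β) hθ hρ)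
        have hray := measurable_ray hq e a β (p β) θ
        fun_prop
    _ = ∫⁻ x, ρ x ^ (3 : ℝ) ∂volS3 := by
        rw [volS3, lintegral_toSphere_eq_lintegral_ray hq e a (by fun_prop) hp]
        refine lintegral_congr fun β => setLIntegral_congr_fun measurableSet_Ioo fun θ hθ =>
          setLIntegral_congr_fun measurableSet_Ioo fun t ht => ?_
        have hspeed := raySpeed_pos e a β (hp β) hθ (Ioo_subset_Icc_self ht)
        rw [ENNReal.mul_rpow_of_nonneg _ _ (by norm_num), mul_assoc]
        congr 1
        rw [ENNReal.ofReal_mul (by positivity), ENNReal.ofReal_rpow_of_pos hspeed]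
        norm_cast

theorem pathModulus_connectingPaths_eq_top {C D : Set S3} (h : ¬ Disjoint C D) (r : ℝ) :
    pathModulus r (connectingPaths C D) = ∞ := by
  obtain ⟨x, hxC, hxD⟩ := not_disjoint_iff.1 h
  refine iInf₂_eq_top.2 fun ρ hρ => ?_
  have hconst := hρ.2 (.const I x) ⟨hxC, hxD⟩
  have := Measure.nullSingletonClass_hausdorff S3 (d := 1) one_pos
  have hrange : range (ContinuousMap.const I x) = {x} := range_const
  rw [hrange] at hconst
  simp at hconst

end LowerBound

section HopfLink

theorem rayLength_ne_zero : rayLength ≠ 0 := by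
  have hone : ∫⁻ _ in Ioo (0 : ℝ) 1, (1 : ℝ≥0∞) ≤ rayLength := by
    refine setLIntegral_mono' measurableSet_Ioo fun t ht => ?_
    rw [ENNReal.rpow_neg, ENNReal.one_le_inv]
    refine ENNReal.rpow_le_one (ENNReal.ofReal_le_one.2 ?_) (by norm_num)
    unfold rayWeight
    nlinarith [ht.1, ht.2, mul_nonneg ht.1.le (sq_nonneg t)]
  intro hzero
  simp [hzero] at hone

theorem rayLength_ne_top : rayLength ≠ ∞ := by
  have hbeta := (intervalIntegrable_iff_integrableOn_Ioo_of_le zero_le_one).1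
    (Complex.betaIntegral_convergent (u := (2⁻¹ : ℝ)) (v := (2⁻¹ : ℝ)) (by norm_num) (by norm_num))
  have hfin := (hbeta.norm.const_mul ((2⁻¹ : ℝ) ^ (-2⁻¹ : ℝ))).lintegral_lt_top
  refine ne_top_of_le_ne_top hfin.ne (setLIntegral_mono' measurableSet_Ioo fun t ht => ?_)
  have ht0 := ht.1
  have ht1 : 0 < 1 - t := sub_pos.2 ht.2
  rw [ENNReal.ofReal_rpow_of_pos (rayWeight_pos ht)]
  refine ENNReal.ofReal_le_ofReal ?_
  rw [norm_mul, Complex.norm_cpow_eq_rpow_re_of_pos ht0, ← Complex.ofReal_one,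
    ← Complex.ofReal_sub 1 t, Complex.norm_cpow_eq_rpow_re_of_pos ht1, ← Complex.ofReal_sub,
    Complex.ofReal_re, show (2⁻¹ - 1 : ℝ) = -2⁻¹ by norm_num, ← Real.mul_rpow ht0.le ht1.le,
    ← Real.mul_rpow (by norm_num) (by positivity)]
  refine Real.rpow_le_rpow_of_nonpos (by positivity) ?_ (by norm_num)
  unfold rayWeight
  nlinarith [mul_pos (mul_pos ht0 ht0) ht1]

/-- The first coordinate `z₁` of a point of `𝕊³ ⊆ ℂ²`. -/
noncomputable def fstCoord (x : S3) : ℂ := ⟨x.1 0, x.1 1⟩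

/-- The second coordinate `z₂` of a point of `𝕊³ ⊆ ℂ²`. -/
noncomputable def sndCoord (x : S3) : ℂ := ⟨x.1 2, x.1 3⟩

@[fun_prop]
theorem continuous_fstCoord : Continuous fstCoord :=
  Complex.equivRealProdCLM.symm.continuous.comp
    (by fun_prop : Continuous fun x : S3 => (x.1 0, x.1 1))

@[fun_prop]
theorem continuous_sndCoord : Continuous sndCoord :=
  Complex.equivRealProdCLM.symm.continuous.comp
    (by fun_prop : Continuous fun x : S3 => (x.1 2, x.1 3))

theorem sq_norm_fstCoord_add_sq_norm_sndCoord (x : S3) :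
    ‖fstCoord x‖ ^ 2 + ‖sndCoord x‖ ^ 2 = 1 := by
  have hx : ‖x.1‖ ^ 2 = 1 := by rw [mem_sphere_zero_iff_norm.1 x.2, one_pow]
  rw [EuclideanSpace.real_norm_sq_eq, Fin.sum_univ_four] at hx
  rw [Complex.sq_norm, Complex.sq_norm, Complex.normSq_apply, Complex.normSq_apply, ← hx]
  simp only [fstCoord, sndCoord]
  ring

theorem dist_sq_eq_dist_fstCoord_sq_add (x y : S3) :
    dist x y ^ 2 = dist (fstCoord x) (fstCoord y) ^ 2 + dist (sndCoord x) (sndCoord y) ^ 2 := by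
  rw [Subtype.dist_eq, EuclideanSpace.dist_eq, Real.sq_sqrt (by positivity), Fin.sum_univ_four,
    Complex.dist_eq_re_im, Complex.dist_eq_re_im, Real.sq_sqrt (by positivity),
    Real.sq_sqrt (by positivity)]
  simp only [Real.dist_eq, sq_abs, fstCoord, sndCoord]
  ring

/-- The function `|z₁| / (1 + |z₂|)` on `𝕊³`, the stereographic coordinate of the point
`(|z₁|, |z₂|)` of the unit circle. It maps `hopf₀` to `1` and `hopf₁` to `0`. -/
noncomputable def hopfParam (x : S3) : ℝ := ‖fstCoord x‖ / (1 + ‖sndCoord x‖)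

@[fun_prop]
theorem continuous_hopfParam : Continuous hopfParam :=
  Continuous.div (by fun_prop) (by fun_prop) fun x => by positivity

theorem hopfParam_of_mem_hopf₀ {x : S3} (hx : x ∈ hopf₀) : hopfParam x = 1 := by
  have hsnd : sndCoord x = 0 := Complex.ext hx.1 hx.2
  have hnorm := sq_norm_fstCoord_add_sq_norm_sndCoord x
  rw [hsnd, norm_zero, zero_pow two_ne_zero, add_zero,
    pow_eq_one_iff_of_nonneg (norm_nonneg _) two_ne_zero] at hnorm
  rw [hopfParam, hsnd, hnorm, norm_zero, add_zero, div_one]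

theorem hopfParam_of_mem_hopf₁ {x : S3} (hx : x ∈ hopf₁) : hopfParam x = 0 := by
  have hfst : fstCoord x = 0 := Complex.ext hx.1 hx.2
  rw [hopfParam, hfst, norm_zero, zero_div]

theorem one_add_hopfParam_sq (x : S3) : 1 + hopfParam x ^ 2 = 2 / (1 + ‖sndCoord x‖) := by
  have := norm_nonneg (sndCoord x)
  rw [hopfParam, div_pow, eq_sub_of_add_eq (sq_norm_fstCoord_add_sq_norm_sndCoord x)]
  field_simp
  ring

theorem dist_hopfParam_sq_le (x y : S3) :
    dist (hopfParam x) (hopfParam y) ^ 2 ≤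
      (1 + hopfParam x ^ 2) / 2 * ((1 + hopfParam y ^ 2) / 2) * dist x y ^ 2 := by
  have hfst : dist ‖fstCoord x‖ ‖fstCoord y‖ ≤ dist (fstCoord x) (fstCoord y) :=
    (dist_norm_norm_le _ _).trans_eq (dist_eq_norm _ _).symm
  have hsnd : dist ‖sndCoord x‖ ‖sndCoord y‖ ≤ dist (sndCoord x) (sndCoord y) :=
    (dist_norm_norm_le _ _).trans_eq (dist_eq_norm _ _).symm
  have hx := sq_norm_fstCoord_add_sq_norm_sndCoord x
  have hy := sq_norm_fstCoord_add_sq_norm_sndCoord y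
  calc dist (hopfParam x) (hopfParam y) ^ 2
      = (1 + hopfParam x ^ 2) / 2 * ((1 + hopfParam y ^ 2) / 2) *
          (dist ‖fstCoord x‖ ‖fstCoord y‖ ^ 2 + dist ‖sndCoord x‖ ‖sndCoord y‖ ^ 2) := by
        rw [one_add_hopfParam_sq, one_add_hopfParam_sq]
        simp only [Real.dist_eq, sq_abs, hopfParam]
        have hxpos : 1 + ‖sndCoord x‖ ≠ 0 := by positivity
        have hypos : 1 + ‖sndCoord y‖ ≠ 0 := by positivity
        field_simp
        linear_combination (1 + ‖sndCoord y‖) * (‖sndCoord y‖ - ‖sndCoord x‖) * hx -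
          (1 + ‖sndCoord x‖) * (‖sndCoord y‖ - ‖sndCoord x‖) * hy
    _ ≤ _ := by
        rw [dist_sq_eq_dist_fstCoord_sq_add]
        gcongr

/-- The extremal density for the paths that connect the components of the Hopf link. It is constant
on the level sets of `hopfParam`, and the gradient lines of `hopfParam` have length `1` for it. -/
noncomputable def hopfDensity (x : S3) : ℝ≥0∞ :=
  rayLength⁻¹ * ENNReal.ofReal (rayWeight (hopfParam x)) ^ (-2⁻¹ : ℝ) *
    ENNReal.ofReal ((1 + hopfParam x ^ 2) / 2)

theorem measurable_hopfDensity : Measurable hopfDensity := by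
  unfold hopfDensity
  fun_prop

theorem hopfDensity_mem_admissible : hopfDensity ∈ Admissible (connectingPaths hopf₀ hopf₁) := by
  refine ⟨measurable_hopfDensity, fun γ ⟨hstart, hend⟩ => ?_⟩
  have hsub : Icc (0 : ℝ) 1 ⊆ hopfParam '' range γ :=
    ((isPreconnected_range γ.continuous).image _ continuous_hopfParam.continuousOn).Icc_subset
      ⟨_, mem_range_self 1, hopfParam_of_mem_hopf₁ hend⟩
      ⟨_, mem_range_self 0, hopfParam_of_mem_hopf₀ hstart⟩
  calc 1 = ∫⁻ t in Ioo (0 : ℝ) 1, rayLength⁻¹ * ENNReal.ofReal (rayWeight t) ^ (-2⁻¹ : ℝ) := by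
        rw [lintegral_const_mul' _ _ (ENNReal.inv_ne_top.2 rayLength_ne_zero)]
        exact (ENNReal.inv_mul_cancel rayLength_ne_zero rayLength_ne_top).symm
    _ ≤ ∫⁻ t in hopfParam '' range γ,
          rayLength⁻¹ * ENNReal.ofReal (rayWeight t) ^ (-2⁻¹ : ℝ) ∂μH[1] := by
        rw [hausdorffMeasure_real]
        exact lintegral_mono_set (Ioo_subset_Icc_self.trans hsub)
    _ ≤ ∫⁻ x in range γ, hopfDensity x ∂μH[1] := by
        have hle := setLIntegral_image_hausdorffMeasure_le zero_le_one
          (isCompact_range γ.continuous).isClosed.measurableSet continuous_hopfParam.measurable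
          (by fun_prop : Measurable fun x => (1 + hopfParam x ^ 2) / 2) (fun x _ => by positivity)
          (fun x _ y _ => dist_hopfParam_sq_le x y)
          (by fun_prop :
            Measurable fun t => rayLength⁻¹ * ENNReal.ofReal (rayWeight t) ^ (-2⁻¹ : ℝ))
        simpa only [ENNReal.rpow_one, hopfDensity] using hle

theorem norm_page_zero {V : Type*} [NormedAddCommGroup V] [InnerProductSpace ℝ V]
    (e : OrthonormalBasis (Fin 3) ℝ V) (β : ℝ) (z : ℂ) : ‖page e 0 β z‖ = ‖z‖ := by
  have hzero : page e 0 β 0 = 0 := by simp [page]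
  simpa only [hzero, dist_zero_right] using (isometry_page e 0 β).dist_eq z 0

theorem raySpeed_zero_two_mul_I {V : Type*} [NormedAddCommGroup V] [InnerProductSpace ℝ V]
    {q : V} (e : OrthonormalBasis (Fin 3) ℝ (ℝ ∙ q)ᗮ) (β : ℝ) {θ t : ℝ}
    (hθ : θ ∈ Ioo (-Real.pi) Real.pi) (ht : t ∈ Icc (0 : ℝ) 1) :
    raySpeed e 0 β (2 * Complex.I) θ t = 2 / (1 + t ^ 2) := by
  have hne := one_add_circleMap_ne_zero hθ ht
  have hnorm : Complex.normSq (circleMap 0 t θ) = t ^ 2 := by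
    rw [← Complex.sq_norm, norm_circleMap_zero, sq_abs]
  rw [raySpeed, stereoFactor, cayleyFactor, norm_page_zero]
  generalize circleMap 0 t θ = w at hne hnorm ⊢
  have hnormSq : Complex.normSq (1 + w) ≠ 0 := (Complex.normSq_pos.2 hne).ne'
  have hcayley : cayley (2 * Complex.I) w = 2 * Complex.I * (1 - w) / (1 + w) := by
    simp only [cayley, map_mul, map_ofNat, Complex.conj_I]
    ring
  have hparallelogram : Complex.normSq (1 + w) + Complex.normSq (1 - w) = 2 * (1 + t ^ 2) := by
    rw [Complex.normSq_add, Complex.normSq_sub, hnorm, map_one]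
    ring
  have hdenom : ‖cayley (2 * Complex.I) w‖ ^ 2 + 4 = 8 * (1 + t ^ 2) / Complex.normSq (1 + w) := by
    rw [hcayley, Complex.sq_norm, Complex.normSq_div, Complex.normSq_mul, Complex.normSq_mul,
      Complex.normSq_I, Complex.normSq_ofNat, eq_sub_of_add_eq' hparallelogram]
    field_simp
    ring
  have him : (2 * Complex.I).im = 2 := by simp
  rw [hdenom, him]
  field_simp
  norm_num

section StandardBasis

variable {e : OrthonormalBasis (Fin 3) ℝ (ℝ ∙ EuclideanSpace.basisFun (Fin 4) ℝ 0)ᗮ}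
  (he : ∀ i, (e i : EuclideanSpace ℝ (Fin 4)) = EuclideanSpace.basisFun (Fin 4) ℝ i.succ)

include he

theorem sndCoord_stereoInvFun_page (β : ℝ) (z : ℂ) :
    sndCoord (stereoInvFun (OrthonormalBasis.norm_eq_one _ 0) (page e 0 β z)) =
      circleMap 0 (stereoFactor (page e 0 β z) * z.im) β := by
  have hcos : (page e 0 β z).1 2 = z.im * Real.cos β := by simp [page, he]
  have hsin : (page e 0 β z).1 3 = z.im * Real.sin β := by simp [page, he]
  rw [Complex.ext_iff, circleMap_zero_re, circleMap_zero_im, mul_assoc, mul_assoc, ← hcos, ← hsin]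
  simp [sndCoord, stereoInvFun_apply, stereoFactor, div_eq_inv_mul, mul_assoc]

theorem hopfParam_ray (β : ℝ) {θ t : ℝ} (hθ : θ ∈ Ioo (-Real.pi) Real.pi)
    (ht : t ∈ Icc (0 : ℝ) 1) :
    hopfParam (ray (OrthonormalBasis.norm_eq_one _ 0) e 0 β (2 * Complex.I) θ t) = t := by
  have hsnd : ‖sndCoord (ray (OrthonormalBasis.norm_eq_one _ 0) e 0 β (2 * Complex.I) θ t)‖ =
      (1 - t ^ 2) / (1 + t ^ 2) := by
    have hheight : 0 ≤ (1 - t ^ 2) / (1 + t ^ 2) :=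
      div_nonneg (by nlinarith [ht.1, ht.2]) (by positivity)
    rw [ray, sndCoord_stereoInvFun_page he, norm_circleMap_zero, im_cayley, ← mul_assoc, ← raySpeed,
      raySpeed_zero_two_mul_I e β hθ ht, norm_circleMap_zero, sq_abs, div_mul_div_comm,
      mul_comm (1 + t ^ 2), mul_div_mul_left _ _ two_ne_zero, abs_of_nonneg hheight]
  have hsq := one_add_hopfParam_sq
    (ray (OrthonormalBasis.norm_eq_one _ 0) e 0 β (2 * Complex.I) θ t)
  have hnonneg : 0 ≤ hopfParam (ray (OrthonormalBasis.norm_eq_one _ 0) e 0 β (2 * Complex.I) θ t) :=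
    div_nonneg (norm_nonneg _) (by positivity)
  rw [hsnd] at hsq
  rw [← sq_eq_sq₀ hnonneg ht.1, eq_sub_of_add_eq' hsq]
  field_simp
  ring

theorem hopfDensity_ray_mul_raySpeed (β : ℝ) {θ t : ℝ} (hθ : θ ∈ Ioo (-Real.pi) Real.pi)
    (ht : t ∈ Icc (0 : ℝ) 1) :
    hopfDensity (ray (OrthonormalBasis.norm_eq_one _ 0) e 0 β (2 * Complex.I) θ t) *
        ENNReal.ofReal (raySpeed e 0 β (2 * Complex.I) θ t) =
      rayLength⁻¹ * ENNReal.ofReal (rayWeight t) ^ (-2⁻¹ : ℝ) := by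
  rw [hopfDensity, hopfParam_ray he β hθ ht, raySpeed_zero_two_mul_I e β hθ ht, mul_assoc,
    ← ENNReal.ofReal_mul (by positivity), div_mul_div_cancel₀ two_ne_zero, div_self (by positivity),
    ENNReal.ofReal_one, mul_one]

theorem hopfDensity_ray_rpow_mul (β : ℝ) {θ t : ℝ} (hθ : θ ∈ Ioo (-Real.pi) Real.pi)
    (ht : t ∈ Ioo (0 : ℝ) 1) :
    hopfDensity (ray (OrthonormalBasis.norm_eq_one _ 0) e 0 β (2 * Complex.I) θ t) ^ (3 : ℝ) *
        ENNReal.ofReal (raySpeed e 0 β (2 * Complex.I) θ t ^ 3 * rayWeight t) =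
      rayLength⁻¹ ^ 3 * ENNReal.ofReal (rayWeight t) ^ (-2⁻¹ : ℝ) := by
  have hweight := (ENNReal.ofReal_pos.2 (rayWeight_pos ht)).ne'
  have hspeed : 0 ≤ raySpeed e 0 β (2 * Complex.I) θ t :=
    (raySpeed_pos e 0 β (by simp) hθ (Ioo_subset_Icc_self ht)).le
  rw [ENNReal.ofReal_mul (by positivity), ENNReal.ofReal_pow hspeed, ← ENNReal.rpow_ofNat,
    ← mul_assoc, ← ENNReal.mul_rpow_of_nonneg _ _ (by norm_num),
    hopfDensity_ray_mul_raySpeed he β hθ (Ioo_subset_Icc_self ht),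
    ENNReal.mul_rpow_of_nonneg _ _ (by norm_num), ← ENNReal.rpow_mul, mul_assoc]
  nth_rewrite 2 [← ENNReal.rpow_one (ENNReal.ofReal (rayWeight t))]
  rw [← ENNReal.rpow_add _ _ hweight ENNReal.ofReal_ne_top]
  norm_num

end StandardBasis

theorem pathModulus_connectingPaths_hopf_le :
    pathModulus 3 (connectingPaths hopf₀ hopf₁) ≤
      ENNReal.ofReal (2 * Real.pi) ^ 2 * (rayLength ^ 2)⁻¹ := by
  obtain ⟨e, he⟩ := exists_orthonormalBasis_coe_eq_succ (EuclideanSpace.basisFun (Fin 4) ℝ)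
  have hmeas := measurable_hopfDensity
  refine (iInf₂_le hopfDensity hopfDensity_mem_admissible).trans_eq ?_
  calc ∫⁻ x, hopfDensity x ^ (3 : ℝ) ∂volS3
      = ∫⁻ β in Ioo (-Real.pi) Real.pi, ∫⁻ θ in Ioo (-Real.pi) Real.pi, ∫⁻ t in Ioo (0 : ℝ) 1,
          rayLength⁻¹ ^ 3 * ENNReal.ofReal (rayWeight t) ^ (-2⁻¹ : ℝ) := by
        rw [volS3, lintegral_toSphere_eq_lintegral_ray (OrthonormalBasis.norm_eq_one _ 0) e 0
          (by fun_prop) (p := fun _ => 2 * Complex.I) fun _ => by simp]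
        exact lintegral_congr fun β => setLIntegral_congr_fun measurableSet_Ioo fun θ hθ =>
          setLIntegral_congr_fun measurableSet_Ioo fun t ht => hopfDensity_ray_rpow_mul he β hθ ht
    _ = ∫⁻ _ in Ioo (-Real.pi) Real.pi, ∫⁻ _ in Ioo (-Real.pi) Real.pi, (rayLength ^ 2)⁻¹ := by
        rw [lintegral_const_mul' _ _
          (ENNReal.pow_ne_top (ENNReal.inv_ne_top.2 rayLength_ne_zero)), ← rayLength, pow_succ,
          mul_assoc, ENNReal.inv_mul_cancel rayLength_ne_zero rayLength_ne_top, mul_one,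
          ENNReal.inv_pow]
    _ = _ := by
        simp only [setLIntegral_const, Real.volume_Ioo, sub_neg_eq_add, ← two_mul]
        ring

end HopfLink

theorem mainTheorem4_general (C₀ C₁ : Set S3) (hcirc : IsCircle C₀)
    (hlink : ¬ NullhomotopicIn C₁ C₀ᶜ) :
    pathModulus 3 (connectingPaths hopf₀ hopf₁) ≤ pathModulus 3 (connectingPaths C₀ C₁) := by
  by_cases hdisj : Disjoint C₀ C₁
  · exact pathModulus_connectingPaths_hopf_le.trans
      (sq_two_pi_mul_inv_sq_rayLength_le_pathModulus hcirc hdisj.subset_compl_left hlink)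
  · exact le_top.trans_eq (pathModulus_connectingPaths_eq_top hdisj 3).symm

theorem mainTheorem4 (C₀ C₁ : Set S3) (h₀ : IsCurve C₀) (h₁ : IsCurve C₁)
    (hlink : Linked C₀ C₁) (hcirc : IsCircle C₀) :
    pathModulus 3 (connectingPaths hopf₀ hopf₁) ≤ pathModulus 3 (connectingPaths C₀ C₁) :=
  mainTheorem4_general C₀ C₁ hcirc hlink.2
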